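/- Conventions. Rings are commutative with unit. A $\sigma$-ring is a ring with a ring endomorphism $\sigma$; a $k$-$\sigma$-algebra is a $k$-algebra $R$ that is a $\sigma$-ring such that $k\to R$ commutes with $\sigma$; morphisms of $k$-$\sigma$-algebras are $k$-algebra morphisms commuting with $\sigma$. $R$ is finitely $\sigma$-generated over $k$ if it is the smallest $\sigma$-stable $k$-subalgebra containing some finite subset of $R$. On $R\otimes_k S$ one puts $\sigma(r\otimes s)=\sigma(r)\otimes\sigma(s)$. A $\sigma$-variety over $k$ is a functor from $k$-$\sigma$-algebras to sets that is representable by a finitely $\sigma$-generated $k$-$\sigma$-algebra; a $\sigma$-algebraic group over $k$ is a group object in the category of $\sigma$-varieties over $k$. For a $k$-$\sigma$-algebra $A$, $X_A$ is the restriction of the functor $X$ to $A$-$\sigma$-algebras. A $G$-torsor is a non-empty $\sigma$-variety $X$ over $k$ (i.e. $X(R)\neq\emptyset$ for some $R\neq 0$; nothing is required if $k=0$) with a functorial left action of $G$ such that $G(R)\times X(R)\to X(R)\times X(R)$, $(g,x)\mapsto(g.x,x)$ is bijective for every $k$-$\sigma$-algebra $R$. Isomorphisms of $G$-torsors are the $G$-equivariant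 isomorphisms of functors. The trivial torsor is $G$ with left multiplication, and $X$ is trivial over $A$ if $X_A\cong G_A$ as $G_A$-torsors. For a $k$-$\sigma$-algebra $A$ let $\delta_1,\delta_2\colon G(A)\to G(A\otimes_kA)$ be induced by $a\mapsto 1\otimes a$ and $a\mapsto a\otimes 1$, and let $\partial_1,\partial_2,\partial_3\colon G(A\otimes_kA)\to G(A\otimes_kA\otimes_kA)$ be induced by $a\otimes b\mapsto 1\otimes a\otimes b$, $a\otimes 1\otimes b$, $a\otimes b\otimes 1$. A 1-cocycle is a $\chi\in G(A\otimes_kA)$ with $\partial_2(\chi)=\partial_1(\chi)\partial_3(\chi)$; cocycles $\chi_1,\chi_2$ are equivalent if $\chi_1=\delta_1(\alpha)\chi_2\delta_2(\alpha)^{-1}$ for some $\alpha\in G(A)$. $H^1_\sigma(A/k,G)$ is the set of equivalence classes of 1-cocycles, pointed by the class of $1$. For a functor $F$ from $A$-$\sigma$-algebras to sets let $A\otimes F$ and $F\otimes A$ be its base changes to $A\otimes_kA$ along $a\mapsto 1\otimes a$ and $a\mapsto a\otimes 1$. An $A/k$-descent datum on $F$ is an isomorphism $\phi\colon A\otimes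 F\to F\otimes A$ such that $\phi_{13}=\phi_{12}\circ\phi_{23}$, where $\phi_{23},\phi_{13},\phi_{12}$ are the extensions of $\phi$ to $A\otimes_k A\otimes_k A$ along $a\otimes b\mapsto 1\otimes a\otimes b$, $a\otimes 1\otimes b$, $a\otimes b\otimes 1$. A morphism $\gamma\colon F\to F'$ is compatible with descent data $\phi,\phi'$ if $\phi'\circ(A\otimes\gamma)=(\gamma\otimes A)\circ\phi$. For a functor $X$ on $k$-$\sigma$-algebras, $X_A$ carries the canonical descent datum, given by the identity maps $X(S)\to X(S)$ for all $A\otimes_kA$-$\sigma$-algebras $S$. Theorem 4.1. Let $k$ be a $\sigma$-ring, $G$ a $\sigma$-algebraic group over $k$ and $A$ a $k$-$\sigma$-algebra that is faithfully flat over $k$. Let $\Sigma_{A/k}(G)$ be the set of $k$-isomorphism classes of $G$-torsors that are trivial over $A$, pointed by the class of the trivial torsor. There is an isomorphism of pointed sets $$\Xi\colon \Sigma_{A/k}(G)\to H^1_\sigma(A/k,G)$$ with the following properties. 1. If $X$ is a $G$-torsor that is trivial over $A$ and $x\in X(A)$, and $f_1,f_2\colon X(A)\to X(A\otimes_kA)$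 are induced by $a\mapsto 1\otimes a$ and $a\mapsto a\otimes 1$, then the unique $\chi\in G(A\otimes_kA)$ with $f_1(x)=\chi.f_2(x)$ is a 1-cocycle, and $\Xi([X])=[\chi]$. 2. For every 1-cocycle $\chi$, the maps $G(S)\to G(S)$, $g\mapsto g\cdot\chi$, for $A\otimes_kA$-$\sigma$-algebras $S$, form an $A/k$-descent datum $\phi_\chi$ on $G_A$; and for a $G$-torsor $X$ that is trivial over $A$ one has $\Xi([X])=[\chi]$ if and only if $(G_A,\phi_\chi)$ descends to $X$, i.e. there is an isomorphism $G_A\to X_A$ of $G_A$-torsors that is compatible with $\phi_\chi$ and the canonical descent datum of $X_A$. -/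

import Mathlib

open CategoryTheory TensorProduct

universe u

/-! ### Difference rings and difference algebras -/

/-- A difference ring (`σ`-ring): a commutative ring with a ring endomorphism `σ`. -/
class SigmaRing (R : Type u) [CommRing R] where
  /-- the distinguished endomorphism -/
  sigma : R →+* R

/-- `R` is a `k`-`σ`-algebra: the structure map `k → R` commutes with `σ`. -/
class SigmaAlgebra (k R : Type u) [CommRing k] [SigmaRing k] [CommRing R] [SigmaRing R]
    [Algebra k R] : Prop where
  algebraMap_sigma : ∀ a : k,
    algebraMap k R (SigmaRing.sigma a) = SigmaRing.sigma (algebraMap k R a)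

/-- Morphisms of `σ`-rings. -/
structure SigmaRingHom (A B : Type u) [CommRing A] [SigmaRing A] [CommRing B] [SigmaRing B] where
  /-- the underlying ring homomorphism -/
  toRingHom : A →+* B
  map_sigma : ∀ a : A, toRingHom (SigmaRing.sigma a) = SigmaRing.sigma (toRingHom a)

/-- The structure map of a `k`-`σ`-algebra as a morphism of `σ`-rings. -/
def SigmaRingHom.ofAlgebra (k R : Type u) [CommRing k] [SigmaRing k] [CommRing R] [SigmaRing R]
    [Algebra k R] [SigmaAlgebra k R] : SigmaRingHom k R where
  toRingHom := algebraMap k R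
  map_sigma := SigmaAlgebra.algebraMap_sigma

/-- The category of `k`-`σ`-algebras (bundled objects). -/
structure SigmaAlg (k : Type u) [CommRing k] [SigmaRing k] : Type (u + 1) where
  /-- the underlying type -/
  carrier : Type u
  [commRing : CommRing carrier]
  [sigmaRing : SigmaRing carrier]
  [algebra : Algebra k carrier]
  [sigmaAlgebra : SigmaAlgebra k carrier]

namespace SigmaAlg

attribute [instance] commRing sigmaRing algebra sigmaAlgebra

variable {k : Type u} [CommRing k] [SigmaRing k]

instance : CoeSort (SigmaAlg k) (Type u) := ⟨carrier⟩

variable (k) in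
/-- Bundle a `k`-`σ`-algebra. -/
abbrev of (R : Type u) [CommRing R] [SigmaRing R] [Algebra k R] [SigmaAlgebra k R] :
    SigmaAlg k := ⟨R⟩

/-- Morphisms of `k`-`σ`-algebras: `k`-algebra morphisms that commute with `σ`. -/
@[ext]
structure Hom (R S : SigmaAlg k) where
  /-- the underlying morphism of `k`-algebras -/
  toAlgHom : R →ₐ[k] S
  map_sigma : ∀ r : R, toAlgHom (SigmaRing.sigma r) = SigmaRing.sigma (toAlgHom r)

instance : Category (SigmaAlg k) where
  Hom R S := Hom R S
  id R := ⟨AlgHom.id k R, fun _ => rfl⟩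
  comp f g := ⟨g.toAlgHom.comp f.toAlgHom, fun r => by simp [f.map_sigma, g.map_sigma]⟩

/-- The morphism of `σ`-rings underlying a morphism of `k`-`σ`-algebras. -/
def Hom.toSigmaRingHom {R S : SigmaAlg k} (f : R ⟶ S) : SigmaRingHom R S where
  toRingHom := f.toAlgHom.toRingHom
  map_sigma := f.map_sigma

/-- `R` is finitely `σ`-generated over `k`: for some finite subset `s` of `R`, the smallest
`k`-subalgebra of `R` that contains `s` and is stable under `σ` is `R` itself. -/
def FinitelyGenerated (R : SigmaAlg k) : Prop :=
  ∃ s : Finset R, ∀ S : Subalgebra k R, (s : Set R) ⊆ S →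
    (∀ x ∈ S, SigmaRing.sigma x ∈ S) → S = ⊤

/-! ### Base change -/

variable {A B C : Type u} [CommRing A] [SigmaRing A] [CommRing B] [SigmaRing B]
  [CommRing C] [SigmaRing C]

/-- A `B`-`σ`-algebra `S`, regarded as an `A`-`σ`-algebra through `f : A → B`. -/
abbrev restrictObj (f : SigmaRingHom A B) (S : SigmaAlg B) : SigmaAlg A :=
  letI : Algebra A S := ((algebraMap B S).comp f.toRingHom).toAlgebra
  haveI : SigmaAlgebra A S :=
    ⟨fun a => by
      change algebraMap B S (f.toRingHom (SigmaRing.sigma a)) =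
        SigmaRing.sigma (algebraMap B S (f.toRingHom a))
      rw [f.map_sigma, SigmaAlgebra.algebraMap_sigma]⟩
  of A S

/-- Restriction of scalars along a morphism `f : A → B` of `σ`-rings, as a functor from
`B`-`σ`-algebras to `A`-`σ`-algebras. The base change to `B` of a functor `F` on `A`-`σ`-algebras
is `restrict f ⋙ F`. -/
def restrict (f : SigmaRingHom A B) : SigmaAlg B ⥤ SigmaAlg A where
  obj S := restrictObj f S
  map {S T} h :=
    { toAlgHom :=
        { toRingHom := h.toAlgHom.toRingHom
          commutes' := fun a => h.toAlgHom.commutes (f.toRingHom a) }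
      map_sigma := h.map_sigma }

/-- If `f : A → B → C` and `f' : A → B' → C` have the same composite, the two ways of regarding a
`C`-`σ`-algebra as an `A`-`σ`-algebra are identified by the identity map. -/
def restrictSquare {B' : Type u} [CommRing B'] [SigmaRing B']
    (f : SigmaRingHom A B) (g : SigmaRingHom B C) (f' : SigmaRingHom A B') (g' : SigmaRingHom B' C)
    (h : ∀ a, g.toRingHom (f.toRingHom a) = g'.toRingHom (f'.toRingHom a)) :
    restrict g ⋙ restrict f ≅ restrict g' ⋙ restrict f' :=
  NatIso.ofComponents
    (fun S =>
      { hom :=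
          { toAlgHom :=
              { toRingHom := RingHom.id S
                commutes' := fun a => congrArg (algebraMap C S) (h a) }
            map_sigma := fun _ => rfl }
        inv :=
          { toAlgHom :=
              { toRingHom := RingHom.id S
                commutes' := fun a => congrArg (algebraMap C S) (h a).symm }
            map_sigma := fun _ => rfl }
        hom_inv_id := rfl
        inv_hom_id := rfl })
    (fun _ => rfl)

end SigmaAlg

/-! ### Tensor products -/

section Tensor

variable (k : Type u) [CommRing k] [SigmaRing k]
  (R S : Type u) [CommRing R] [SigmaRing R] [Algebra k R] [SigmaAlgebra k R]
  [CommRing S] [SigmaRing S] [Algebra k S] [SigmaAlgebra k S]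

/-- `R ⊗ S` is a `σ`-ring through `σ (r ⊗ s) = σ r ⊗ σ s`. -/
noncomputable instance : SigmaRing (R ⊗[k] S) where
  sigma := Algebra.TensorProduct.mapRingHom (SigmaRing.sigma (R := k)) SigmaRing.sigma
    SigmaRing.sigma
    (RingHom.ext fun a => (SigmaAlgebra.algebraMap_sigma (R := R) a).symm)
    (RingHom.ext fun a => (SigmaAlgebra.algebraMap_sigma (R := S) a).symm)

theorem sigma_tmul (r : R) (s : S) :
    SigmaRing.sigma (r ⊗ₜ[k] s) = SigmaRing.sigma r ⊗ₜ[k] SigmaRing.sigma s :=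
  Algebra.TensorProduct.mapRingHom_tmul _ _ _ _ _ r s

instance : SigmaAlgebra k (R ⊗[k] S) where
  algebraMap_sigma a := by
    simp [Algebra.TensorProduct.algebraMap_apply, sigma_tmul, SigmaAlgebra.algebraMap_sigma]

end Tensor

namespace SigmaAlg

variable (k : Type u) [CommRing k] [SigmaRing k]
  (A : Type u) [CommRing A] [SigmaRing A] [Algebra k A] [SigmaAlgebra k A]

/-- `a ↦ a ⊗ 1`. -/
noncomputable def inclLeft : of k A ⟶ of k (A ⊗[k] A) where
  toAlgHom := Algebra.TensorProduct.includeLeft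
  map_sigma a := by simp [sigma_tmul]

/-- `a ↦ 1 ⊗ a`. -/
noncomputable def inclRight : of k A ⟶ of k (A ⊗[k] A) where
  toAlgHom := Algebra.TensorProduct.includeRight
  map_sigma a := by simp [sigma_tmul]

/-- `a ⊗ b ↦ 1 ⊗ a ⊗ b`. -/
noncomputable def face₁ : of k (A ⊗[k] A) ⟶ of k (A ⊗[k] (A ⊗[k] A)) where
  toAlgHom := Algebra.TensorProduct.includeRight
  map_sigma a := by simp [sigma_tmul]

/-- `a ⊗ b ↦ a ⊗ 1 ⊗ b`. -/
noncomputable def face₂ : of k (A ⊗[k] A) ⟶ of k (A ⊗[k] (A ⊗[k] A)) where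
  toAlgHom := Algebra.TensorProduct.map (AlgHom.id k A) Algebra.TensorProduct.includeRight
  map_sigma := fun (a : A ⊗[k] A) => by
    induction a with
    | zero => simp
    | tmul x y => simp [sigma_tmul]
    | add x y hx hy => simp only [map_add, hx, hy]

/-- `a ⊗ b ↦ a ⊗ b ⊗ 1`. -/
noncomputable def face₃ : of k (A ⊗[k] A) ⟶ of k (A ⊗[k] (A ⊗[k] A)) where
  toAlgHom := Algebra.TensorProduct.map (AlgHom.id k A) Algebra.TensorProduct.includeLeft
  map_sigma := fun (a : A ⊗[k] A) => by
    induction a with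
    | zero => simp
    | tmul x y => simp [sigma_tmul]
    | add x y hx hy => simp only [map_add, hx, hy]

end SigmaAlg

/-! ### Varieties, groups and torsors -/

section Torsors

variable {k : Type u} [CommRing k] [SigmaRing k]

/-- A `k`-`σ`-variety: a functor from `k`-`σ`-algebras to sets that is representable by a finitely
`σ`-generated `k`-`σ`-algebra. -/
def IsSigmaVariety (X : SigmaAlg k ⥤ Type u) : Prop :=
  ∃ B : SigmaAlg k, B.FinitelyGenerated ∧ Nonempty (X.CorepresentableBy B)

variable (k) in
/-- A `σ`-algebraic group over `k`, i.e. a group object in the category of `k`-`σ`-varieties.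
As products of `σ`-varieties are formed pointwise, this is a functor to groups whose underlying
functor to sets is a `σ`-variety. -/
structure SigmaAlgebraicGroup where
  /-- the functor of points -/
  points : SigmaAlg k ⥤ GrpCat.{u}
  isSigmaVariety : IsSigmaVariety (points ⋙ forget GrpCat)

/-- A functor on `k`-`σ`-algebras with a functorial (left) action of the group functor `G`. -/
structure GFunctor (G : SigmaAlg k ⥤ GrpCat.{u}) where
  /-- the functor of points -/
  points : SigmaAlg k ⥤ Type u
  /-- the action of `G(R)` on `X(R)` -/
  [mulAction : ∀ R, MulAction (G.obj R) (points.obj R)]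
  map_smul : ∀ {R S : SigmaAlg k} (f : R ⟶ S) (g : G.obj R) (x : points.obj R),
    points.map f (g • x) = G.map f g • points.map f x

namespace GFunctor

attribute [instance] mulAction

/-- `G` acting on itself by multiplication from the left. -/
def self (G : SigmaAlg k ⥤ GrpCat.{u}) : GFunctor G where
  points := G ⋙ forget GrpCat
  mulAction R := inferInstanceAs (MulAction (G.obj R) (G.obj R))
  map_smul f g x := map_mul (G.map f).hom g x

/-- The base change `X_A` with its action of `G_A`, along a morphism `f : k → A` of `σ`-rings. -/
def baseChange {G : SigmaAlg k ⥤ GrpCat.{u}} (X : GFunctor G) {A : Type u} [CommRing A]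
    [SigmaRing A] (f : SigmaRingHom k A) : GFunctor (SigmaAlg.restrict f ⋙ G) where
  points := SigmaAlg.restrict f ⋙ X.points
  mulAction R := X.mulAction ((SigmaAlg.restrict f).obj R)
  map_smul h g x := X.map_smul ((SigmaAlg.restrict f).map h) g x

/-- `G`-equivariant isomorphisms of functors. -/
structure Iso {G : SigmaAlg k ⥤ GrpCat.{u}} (X Y : GFunctor G) where
  /-- the underlying isomorphism of functors -/
  iso : X.points ≅ Y.points
  map_smul : ∀ (R : SigmaAlg k) (g : G.obj R) (x : X.points.obj R),
    iso.hom.app R (g • x) = g • iso.hom.app R x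

/-- Isomorphism is an equivalence relation. -/
theorem iso_equivalence (G : SigmaAlg k ⥤ GrpCat.{u}) :
    Equivalence (fun X Y : GFunctor G => Nonempty (Iso X Y)) where
  refl X := ⟨⟨CategoryTheory.Iso.refl _, fun _ _ _ => rfl⟩⟩
  symm := by
    rintro X Y ⟨⟨i, hi⟩⟩
    refine ⟨⟨i.symm, fun R g y => ?_⟩⟩
    have h := hi R g (i.inv.app R y)
    have e1 : ∀ z, i.hom.app R (i.inv.app R z) = z := fun z => by simp
    have e2 : ∀ z, i.inv.app R (i.hom.app R z) = z := fun z => by simp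
    rw [e1] at h
    change i.inv.app R (g • y) = g • i.inv.app R y
    rw [← h, e2]
  trans := by
    rintro X Y Z ⟨⟨i, hi⟩⟩ ⟨⟨j, hj⟩⟩
    refine ⟨⟨i ≪≫ j, fun R g x => ?_⟩⟩
    change j.hom.app R (i.hom.app R (g • x)) = g • j.hom.app R (i.hom.app R x)
    rw [hi, hj]

end GFunctor

/-- A `G`-torsor: a non-empty `σ`-variety `X` over `k` with an action of `G` such that
`G(R) × X(R) → X(R) × X(R)`, `(g, x) ↦ (g.x, x)`, is bijective for every `k`-`σ`-algebra `R`.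
Every `σ`-variety has exactly one point over the zero ring, so "non-empty" means that there is a
point over some non-zero `R`; over `k = 0` there is no such `R` and nothing is required. -/
structure SigmaTorsor (G : SigmaAlgebraicGroup k) extends GFunctor G.points where
  isSigmaVariety : IsSigmaVariety points
  nonempty : Nontrivial k → ∃ R : SigmaAlg k, Nontrivial R ∧ Nonempty (points.obj R)
  bijective : ∀ R : SigmaAlg k, Function.Bijective
    (fun p : G.points.obj R × points.obj R => (p.1 • p.2, p.2))

/-- The trivial torsor: `G` acting on itself by left multiplication. -/
def SigmaTorsor.self (G : SigmaAlgebraicGroup k) : SigmaTorsor G where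
  toGFunctor := GFunctor.self G.points
  isSigmaVariety := G.isSigmaVariety
  nonempty h :=
    haveI : SigmaAlgebra k k := ⟨fun _ => rfl⟩
    ⟨SigmaAlg.of k k, h, ⟨(1 : G.points.obj (SigmaAlg.of k k))⟩⟩
  bijective R := by
    change Function.Bijective
      (fun p : G.points.obj R × G.points.obj R => (p.1 * p.2, p.2))
    refine ⟨?_, ?_⟩
    · rintro ⟨a, b⟩ ⟨c, d⟩ h
      simp only [Prod.mk.injEq] at h ⊢
      obtain ⟨h1, rfl⟩ := h
      exact ⟨mul_right_cancel h1, rfl⟩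
    · rintro ⟨a, b⟩
      exact ⟨(a * b⁻¹, b), by simp⟩

variable (A : Type u) [CommRing A] [SigmaRing A] [Algebra k A] [SigmaAlgebra k A]

/-- `X` is trivial over `A`: `X_A` and `G_A` are isomorphic as `G_A`-torsors. -/
def SigmaTorsor.IsTrivialOver {G : SigmaAlgebraicGroup k} (X : SigmaTorsor G) : Prop :=
  Nonempty (GFunctor.Iso (X.toGFunctor.baseChange (SigmaRingHom.ofAlgebra k A))
    ((GFunctor.self G.points).baseChange (SigmaRingHom.ofAlgebra k A)))

variable (G : SigmaAlgebraicGroup k)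

/-- Isomorphism over `k`, on the `G`-torsors that are trivial over `A`. -/
instance trivialTorsorSetoid : Setoid {X : SigmaTorsor G // X.IsTrivialOver A} where
  r X Y := Nonempty (GFunctor.Iso X.1.toGFunctor Y.1.toGFunctor)
  iseqv := (GFunctor.iso_equivalence G.points).comap
    (fun X : {X : SigmaTorsor G // X.IsTrivialOver A} => X.1.toGFunctor)

/-- `Σ_{A/k}(G)`: the set of `k`-isomorphism classes of `G`-torsors that are trivial over `A`. -/
def TorsorClasses : Type (u + 1) := Quotient (trivialTorsorSetoid A G)

variable {A G} in
/-- The isomorphism class of a torsor. -/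
def TorsorClasses.mk (X : SigmaTorsor G) (hX : X.IsTrivialOver A) : TorsorClasses A G :=
  Quotient.mk (trivialTorsorSetoid A G) ⟨X, hX⟩

/-- The distinguished element: the class of the trivial torsor. -/
def TorsorClasses.base : TorsorClasses A G :=
  TorsorClasses.mk (SigmaTorsor.self G) ((GFunctor.iso_equivalence _).refl _)

/-! ### Cohomology -/

variable {A G} in
/-- `χ ∈ G(A ⊗ A)` is a 1-cocycle: `∂₂ χ = ∂₁ χ · ∂₃ χ`. -/
def IsCocycle (χ : G.points.obj (SigmaAlg.of k (A ⊗[k] A))) : Prop :=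
  G.points.map (SigmaAlg.face₂ k A) χ =
    G.points.map (SigmaAlg.face₁ k A) χ * G.points.map (SigmaAlg.face₃ k A) χ

/-- The set `Z¹(A/k, G)` of 1-cocycles. -/
def Cocycle : Type u := {χ : G.points.obj (SigmaAlg.of k (A ⊗[k] A)) // IsCocycle χ}

/-- Equivalence of cocycles: `χ₁ = δ₁(α) χ₂ δ₂(α)⁻¹` for some `α ∈ G(A)`, where `δ₁` and `δ₂` are
induced by `a ↦ 1 ⊗ a` and `a ↦ a ⊗ 1`. -/
instance cocycleSetoid : Setoid (Cocycle A G) where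
  r χ₁ χ₂ := ∃ α : G.points.obj (SigmaAlg.of k A),
    χ₁.1 = G.points.map (SigmaAlg.inclRight k A) α * χ₂.1 *
      (G.points.map (SigmaAlg.inclLeft k A) α)⁻¹
  iseqv :=
    { refl := fun χ => ⟨1, by simp⟩
      symm := by
        rintro χ₁ χ₂ ⟨α, h⟩
        exact ⟨α⁻¹, by simp [h, mul_assoc]⟩
      trans := by
        rintro χ₁ χ₂ χ₃ ⟨α, h⟩ ⟨β, h'⟩
        exact ⟨α * β, by simp [h, h', mul_assoc]⟩ }

/-- The cohomology set `H¹(A/k, G)`. -/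
def H1 : Type u := Quotient (cocycleSetoid A G)

variable {A G} in
/-- The class of a cocycle. -/
def H1.mk (χ : Cocycle A G) : H1 A G := Quotient.mk (cocycleSetoid A G) χ

/-- The distinguished element: the class of `1`. -/
noncomputable def H1.base : H1 A G := H1.mk ⟨1, by simp [IsCocycle]⟩

end Torsors

/-! ### Descent data -/

section Descent

open SigmaAlg

variable (k : Type u) [CommRing k] [SigmaRing k]
  (A : Type u) [CommRing A] [SigmaRing A] [Algebra k A] [SigmaAlgebra k A]

/-- For a functor `F` on `A`-`σ`-algebras, `A ⊗ F` is its base change along `a ↦ 1 ⊗ a`. -/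
noncomputable abbrev tensorLeft (F : SigmaAlg A ⥤ Type u) : SigmaAlg (A ⊗[k] A) ⥤ Type u :=
  restrict (inclRight k A).toSigmaRingHom ⋙ F

/-- For a functor `F` on `A`-`σ`-algebras, `F ⊗ A` is its base change along `a ↦ a ⊗ 1`. -/
noncomputable abbrev tensorRight (F : SigmaAlg A ⥤ Type u) : SigmaAlg (A ⊗[k] A) ⥤ Type u :=
  restrict (inclLeft k A).toSigmaRingHom ⋙ F

/-- The identification `A ⊗ A ⊗ F`, for the two ways `∂₁`, `∂₂` of extending `A ⊗ F`. -/
noncomputable def third₁₂ :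
    restrict (face₁ k A).toSigmaRingHom ⋙ restrict (inclRight k A).toSigmaRingHom ≅
      restrict (face₂ k A).toSigmaRingHom ⋙ restrict (inclRight k A).toSigmaRingHom :=
  restrictSquare _ _ _ _ fun a => by
    change (face₁ k A).toAlgHom ((inclRight k A).toAlgHom a) =
      (face₂ k A).toAlgHom ((inclRight k A).toAlgHom a)
    simp [face₁, face₂, inclRight]

/-- The identification `A ⊗ F ⊗ A`, for `∂₁` applied to `F ⊗ A` and `∂₃` applied to `A ⊗ F`. -/
noncomputable def second₁₃ :
    restrict (face₁ k A).toSigmaRingHom ⋙ restrict (inclLeft k A).toSigmaRingHom ≅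
      restrict (face₃ k A).toSigmaRingHom ⋙ restrict (inclRight k A).toSigmaRingHom :=
  restrictSquare _ _ _ _ fun a => by
    change (face₁ k A).toAlgHom ((inclLeft k A).toAlgHom a) =
      (face₃ k A).toAlgHom ((inclRight k A).toAlgHom a)
    simp [face₁, face₃, inclRight, inclLeft]

/-- The identification `F ⊗ A ⊗ A`, for the two ways `∂₂`, `∂₃` of extending `F ⊗ A`. -/
noncomputable def first₂₃ :
    restrict (face₂ k A).toSigmaRingHom ⋙ restrict (inclLeft k A).toSigmaRingHom ≅
      restrict (face₃ k A).toSigmaRingHom ⋙ restrict (inclLeft k A).toSigmaRingHom :=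
  restrictSquare _ _ _ _ fun a => by
    change (face₂ k A).toAlgHom ((inclLeft k A).toAlgHom a) =
      (face₃ k A).toAlgHom ((inclLeft k A).toAlgHom a)
    simp [face₂, face₃, inclLeft]

variable {k A} in
/-- `φ : A ⊗ F ≅ F ⊗ A` is an `A/k`-descent datum on `F`: `φ₁₃ = φ₁₂ ∘ φ₂₃`, where `φ₂₃`, `φ₁₃`,
`φ₁₂` are the extensions of `φ` along `∂₁`, `∂₂`, `∂₃`. -/
def IsDescentDatum (F : SigmaAlg A ⥤ Type u) (φ : tensorLeft k A F ≅ tensorRight k A F) : Prop :=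
  ∀ (T : SigmaAlg (A ⊗[k] (A ⊗[k] A)))
    (x : (tensorLeft k A F).obj ((restrict (face₁ k A).toSigmaRingHom).obj T)),
    F.map ((first₂₃ k A).hom.app T)
        (φ.hom.app ((restrict (face₂ k A).toSigmaRingHom).obj T)
          (F.map ((third₁₂ k A).hom.app T) x)) =
      φ.hom.app ((restrict (face₃ k A).toSigmaRingHom).obj T)
        (F.map ((second₁₃ k A).hom.app T)
          (φ.hom.app ((restrict (face₁ k A).toSigmaRingHom).obj T) x))

variable {k A} in
/-- A morphism `γ : F ⟶ F'` is compatible with `φ` and `φ'`: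
`φ' ∘ (A ⊗ γ) = (γ ⊗ A) ∘ φ`. -/
def CompatibleWithDescent {F F' : SigmaAlg A ⥤ Type u} (φ : tensorLeft k A F ≅ tensorRight k A F)
    (φ' : tensorLeft k A F' ≅ tensorRight k A F') (γ : F ⟶ F') : Prop :=
  Functor.whiskerLeft (restrict (inclRight k A).toSigmaRingHom) γ ≫ φ'.hom =
    φ.hom ≫ Functor.whiskerLeft (restrict (inclLeft k A).toSigmaRingHom) γ

/-- The two maps `A ⇉ A ⊗ A` agree on `k`, so the two ways of regarding an `A ⊗ A`-`σ`-algebra as a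
`k`-`σ`-algebra are identified by the identity map. -/
noncomputable def restrictBase :
    restrict (inclRight k A).toSigmaRingHom ⋙ restrict (SigmaRingHom.ofAlgebra k A) ≅
      restrict (inclLeft k A).toSigmaRingHom ⋙ restrict (SigmaRingHom.ofAlgebra k A) :=
  restrictSquare _ _ _ _ fun a => by
    change (inclRight k A).toAlgHom (algebraMap k A a) = (inclLeft k A).toAlgHom (algebraMap k A a)
    rw [AlgHom.commutes, AlgHom.commutes]

variable {k} in
/-- The canonical `A/k`-descent datum on the base change to `A` of a functor on
`k`-`σ`-algebras. -/
noncomputable def canonicalDatum (X : SigmaAlg k ⥤ Type u) :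
    tensorLeft k A (restrict (SigmaRingHom.ofAlgebra k A) ⋙ X) ≅
      tensorRight k A (restrict (SigmaRingHom.ofAlgebra k A) ⋙ X) :=
  Functor.isoWhiskerRight (restrictBase k A) X

/-- The structure map `A ⊗ A → S` of an `A ⊗ A`-`σ`-algebra `S`, as a morphism of
`k`-`σ`-algebras. -/
noncomputable def structureMap (S : SigmaAlg (A ⊗[k] A)) :
    of k (A ⊗[k] A) ⟶
      (restrict (inclLeft k A).toSigmaRingHom ⋙ restrict (SigmaRingHom.ofAlgebra k A)).obj S where
  toAlgHom :=
    { toRingHom := algebraMap (A ⊗[k] A) S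
      commutes' := fun _ => rfl }
  map_sigma := SigmaAlgebra.algebraMap_sigma (k := A ⊗[k] A) (R := S)

variable {k A} in
/-- Right multiplication `G(S) → G(S)`, `g ↦ g · χ`, for all `A ⊗ A`-`σ`-algebras `S`, as an
isomorphism `A ⊗ G_A ≅ G_A ⊗ A`. -/
noncomputable def rightMulDatum (G : SigmaAlgebraicGroup k)
    (χ : G.points.obj (of k (A ⊗[k] A))) :
    tensorLeft k A (restrict (SigmaRingHom.ofAlgebra k A) ⋙ (G.points ⋙ forget GrpCat)) ≅
      tensorRight k A (restrict (SigmaRingHom.ofAlgebra k A) ⋙ (G.points ⋙ forget GrpCat)) :=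
  canonicalDatum A (G.points ⋙ forget GrpCat) ≪≫
    NatIso.ofComponents
      (fun S => (Equiv.mulRight (G.points.map (structureMap k A S) χ)).toIso)
      (fun {S T} f => by
        ext g
        have h : structureMap k A S ≫ (restrict (inclLeft k A).toSigmaRingHom ⋙
            restrict (SigmaRingHom.ofAlgebra k A)).map f = structureMap k A T := by
          apply SigmaAlg.Hom.ext
          apply AlgHom.ext
          intro a
          exact f.toAlgHom.commutes a
        have h' : G.points.map (structureMap k A T) χ = G.points.map
            ((restrict (inclLeft k A).toSigmaRingHom ⋙
              restrict (SigmaRingHom.ofAlgebra k A)).map f)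
            (G.points.map (structureMap k A S) χ) := by
          rw [← h, G.points.map_comp]
          rfl
        change _ * G.points.map (structureMap k A T) χ = _
        rw [h']
        exact (map_mul (G.points.map ((restrict (inclLeft k A).toSigmaRingHom ⋙
          restrict (SigmaRingHom.ofAlgebra k A)).map f)).hom _ _).symm)

end Descent

/-! A trivialization of `X` over `A` is the same as a point `x ∈ X(A)`. Its two pullbacks to `A ⊗ A`
differ by a unique `χ`, and comparing the three pullbacks to `A ⊗ A ⊗ A` shows that `χ` is a cocycle
(`IsDifference.isCocycle`). Moving `x` by `α ∈ G(A)` changes `χ` exactly by the equivalence relation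
on cocycles, so the class of `χ` depends only on the isomorphism class of `X`, and every cocycle in
that class comes from some point of `X`.

Injectivity: let `x ∈ X(A)` and `y ∈ Y(A)` have the same `χ`. For `z ∈ X(R)` write `z = g.x` over `A
⊗ R`. Whether `g.x` descends to `R` is a condition on `g` and `χ` alone, so `g.y` descends as well,
and `z ↦ g.y` is an isomorphism (`exists_transport`, `nonempty_iso_of_isDifference`). This uses that
`σ`-varieties satisfy the sheaf condition for `R → A ⊗ R`.

Surjectivity: the twist of `G` by `χ` consists of the `g ∈ G(A ⊗ R)` that satisfy the descent
condition for `χ`. The main work is its representability (`twist_isSigmaVariety`). If `B` represents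
`G`, right translation by `χ` gives a coaction on `A ⊗ B`; by `isIso_lift_equalizerι` its
coinvariants `C` satisfy `A ⊗ C ≅ A ⊗ B`, and `C` represents the twist. Finite `σ`-generation passes
from `B` to `C` by faithful flatness.

Descent data: an equivariant isomorphism `G_A → X_A` has the form `g ↦ g.x`, and it is compatible
with `φ_χ` exactly when `χ` is the difference of the pullbacks of `x` (`compatible_iff`). -/

namespace SigmaAlg

/-! ### Isomorphisms and equalizers of difference algebras -/

section Category

variable {k : Type u} [CommRing k] [SigmaRing k]

theorem comp_apply {R S T : SigmaAlg k} (f : R ⟶ S) (g : S ⟶ T) (r : R) :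
    (f ≫ g).toAlgHom r = g.toAlgHom (f.toAlgHom r) := rfl

theorem hom_ext {R S : SigmaAlg k} {f g : R ⟶ S} (h : ∀ r, f.toAlgHom r = g.toAlgHom r) :
    f = g :=
  Hom.ext (AlgHom.ext h)

theorem congr_apply {R S : SigmaAlg k} {f g : R ⟶ S} (h : f = g) (r : R) :
    f.toAlgHom r = g.toAlgHom r := by rw [h]

theorem isIso_of_bijective {R S : SigmaAlg k} (f : R ⟶ S)
    (hf : Function.Bijective f.toAlgHom) : IsIso f := by
  let e : R ≃ₐ[k] S := AlgEquiv.ofBijective f.toAlgHom hf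
  refine ⟨⟨⟨e.symm.toAlgHom, fun s => ?_⟩, hom_ext fun r => e.symm_apply_apply r,
    hom_ext fun s => e.apply_symm_apply s⟩⟩
  apply e.injective
  change e (e.symm _) = f.toAlgHom _
  rw [f.map_sigma, e.apply_symm_apply]
  exact congrArg _ (e.apply_symm_apply s).symm

/-- The difference subalgebra on which two morphisms agree. -/
def equalizer {R S : SigmaAlg k} (f g : R ⟶ S) : SigmaAlg k :=
  letI : SigmaRing (AlgHom.equalizer f.toAlgHom g.toAlgHom) :=
    ⟨((SigmaRing.sigma (R := R)).comp
        (AlgHom.equalizer f.toAlgHom g.toAlgHom).val.toRingHom).codRestrict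
      (AlgHom.equalizer f.toAlgHom g.toAlgHom) fun x => by
        change f.toAlgHom (SigmaRing.sigma x.1) = g.toAlgHom (SigmaRing.sigma x.1)
        rw [f.map_sigma, g.map_sigma, show f.toAlgHom x.1 = g.toAlgHom x.1 from x.2]⟩
  haveI : SigmaAlgebra k (AlgHom.equalizer f.toAlgHom g.toAlgHom) :=
    ⟨fun a => Subtype.ext (SigmaAlgebra.algebraMap_sigma (R := R) a)⟩
  of k (AlgHom.equalizer f.toAlgHom g.toAlgHom)

/-- The inclusion of the equalizer. -/
def equalizerι {R S : SigmaAlg k} (f g : R ⟶ S) : equalizer f g ⟶ R where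
  toAlgHom := (AlgHom.equalizer f.toAlgHom g.toAlgHom).val
  map_sigma _ := rfl

theorem equalizerι_injective {R S : SigmaAlg k} (f g : R ⟶ S) :
    Function.Injective (equalizerι f g).toAlgHom :=
  Subtype.val_injective

theorem equalizer_condition {R S : SigmaAlg k} (f g : R ⟶ S) :
    equalizerι f g ≫ f = equalizerι f g ≫ g :=
  hom_ext fun r => r.2

/-- A morphism with values in the equalizer. -/
def equalizerLift {R S T : SigmaAlg k} (f g : R ⟶ S) (h : T ⟶ R) (w : h ≫ f = h ≫ g) :
    T ⟶ equalizer f g where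
  toAlgHom := h.toAlgHom.codRestrict _ fun t => congr_apply w t
  map_sigma t := Subtype.ext (h.map_sigma t)

theorem equalizerLift_ι {R S T : SigmaAlg k} (f g : R ⟶ S) (h : T ⟶ R) (w : h ≫ f = h ≫ g) :
    equalizerLift f g h w ≫ equalizerι f g = h := rfl

end Category

/-! ### The coproduct `A ⊗ -`, and descent along `k → A` -/

section Tensor

variable {k : Type u} [CommRing k] [SigmaRing k]
  (A : Type u) [CommRing A] [SigmaRing A] [Algebra k A] [SigmaAlgebra k A]

/-- The coproduct `A ⊗ R` of difference algebras. -/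
noncomputable abbrev tensor (R : SigmaAlg k) : SigmaAlg k := of k (A ⊗[k] R)

/-- `a ↦ a ⊗ 1`. -/
noncomputable def tensorInl (R : SigmaAlg k) : of k A ⟶ tensor A R where
  toAlgHom := Algebra.TensorProduct.includeLeft
  map_sigma a := by simp [sigma_tmul]

/-- `r ↦ 1 ⊗ r`. -/
noncomputable def tensorInr (R : SigmaAlg k) : R ⟶ tensor A R where
  toAlgHom := Algebra.TensorProduct.includeRight
  map_sigma a := by simp [sigma_tmul]

variable {A}

/-- The morphism `a ⊗ r ↦ f a * g r`. -/
noncomputable def tensorLift {R S : SigmaAlg k} (f : of k A ⟶ S) (g : R ⟶ S) :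
    tensor A R ⟶ S where
  toAlgHom := Algebra.TensorProduct.productMap f.toAlgHom g.toAlgHom
  map_sigma x := by
    change A ⊗[k] R at x
    induction x with
    | zero => simp
    | tmul x y =>
      rw [sigma_tmul, Algebra.TensorProduct.productMap_apply_tmul,
        Algebra.TensorProduct.productMap_apply_tmul, map_mul]
      exact congrArg₂ _ (f.map_sigma x) (g.map_sigma y)
    | add x y hx hy => simp only [map_add, hx, hy]

theorem tensorLift_tmul {R S : SigmaAlg k} (f : of k A ⟶ S) (g : R ⟶ S) (a : A) (r : R) :
    (tensorLift f g).toAlgHom (a ⊗ₜ[k] r) = f.toAlgHom a * g.toAlgHom r :=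
  Algebra.TensorProduct.productMap_apply_tmul _ _ _ _

@[simp]
theorem tensorInl_lift {R S : SigmaAlg k} (f : of k A ⟶ S) (g : R ⟶ S) :
    tensorInl A R ≫ tensorLift f g = f :=
  hom_ext fun a => by
    refine (tensorLift_tmul f g a 1).trans ?_
    rw [map_one, mul_one]

@[simp]
theorem tensorInl_lift_assoc {R S : SigmaAlg k} (f : of k A ⟶ S) (g : R ⟶ S)
    {Z : SigmaAlg k} (z : _ ⟶ Z) :
    tensorInl A R ≫ tensorLift f g ≫ z = f ≫ z := by
  rw [← Category.assoc, tensorInl_lift]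

@[simp]
theorem tensorInr_lift {R S : SigmaAlg k} (f : of k A ⟶ S) (g : R ⟶ S) :
    tensorInr A R ≫ tensorLift f g = g :=
  hom_ext fun r => by
    refine (tensorLift_tmul f g 1 r).trans ?_
    rw [map_one, one_mul]

@[simp]
theorem tensorInr_lift_assoc {R S : SigmaAlg k} (f : of k A ⟶ S) (g : R ⟶ S)
    {Z : SigmaAlg k} (z : _ ⟶ Z) :
    tensorInr A R ≫ tensorLift f g ≫ z = g ≫ z := by
  rw [← Category.assoc, tensorInr_lift]

theorem tensor_hom_ext {R S : SigmaAlg k} {f g : tensor A R ⟶ S}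
    (hl : tensorInl A R ≫ f = tensorInl A R ≫ g) (hr : tensorInr A R ≫ f = tensorInr A R ≫ g) :
    f = g :=
  Hom.ext (Algebra.TensorProduct.ext' fun a r => by
    rw [← mul_one a, ← one_mul r, ← Algebra.TensorProduct.tmul_mul_tmul, map_mul, map_mul]
    exact congrArg₂ _ (congr_apply hl a) (congr_apply hr r))

variable (A) in
/-- Functoriality of `A ⊗ -`. -/
noncomputable def tensorMap {R S : SigmaAlg k} (f : R ⟶ S) : tensor A R ⟶ tensor A S :=
  tensorLift (tensorInl A S) (f ≫ tensorInr A S)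

@[simp]
theorem tensorInl_map {R S : SigmaAlg k} (f : R ⟶ S) :
    tensorInl A R ≫ tensorMap A f = tensorInl A S :=
  tensorInl_lift _ _

@[simp]
theorem tensorInl_map_assoc {R S : SigmaAlg k} (f : R ⟶ S) {Z : SigmaAlg k} (z : _ ⟶ Z) :
    tensorInl A R ≫ tensorMap A f ≫ z = tensorInl A S ≫ z := by
  rw [← Category.assoc, tensorInl_map]

@[simp]
theorem tensorInr_map {R S : SigmaAlg k} (f : R ⟶ S) :
    tensorInr A R ≫ tensorMap A f = f ≫ tensorInr A S :=
  tensorInr_lift _ _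

@[simp]
theorem tensorInr_map_assoc {R S : SigmaAlg k} (f : R ⟶ S) {Z : SigmaAlg k} (z : _ ⟶ Z) :
    tensorInr A R ≫ tensorMap A f ≫ z = f ≫ tensorInr A S ≫ z := by
  rw [← Category.assoc, tensorInr_map, Category.assoc]

@[simp]
theorem tensorMap_lift {R S T : SigmaAlg k} (h : R ⟶ S) (f : of k A ⟶ T) (g : S ⟶ T) :
    tensorMap A h ≫ tensorLift f g = tensorLift f (h ≫ g) := by
  apply tensor_hom_ext <;> simp

theorem tensorLift_comp {R S T : SigmaAlg k} (f : of k A ⟶ S) (g : R ⟶ S) (h : S ⟶ T) :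
    tensorLift f g ≫ h = tensorLift (f ≫ h) (g ≫ h) := by
  apply tensor_hom_ext <;> simp

theorem tensorMap_comp {R S T : SigmaAlg k} (f : R ⟶ S) (g : S ⟶ T) :
    tensorMap A (f ≫ g) = tensorMap A f ≫ tensorMap A g := by
  apply tensor_hom_ext <;> simp

/-- Makes the flatness results for linear maps available for morphisms of difference algebras. -/
theorem tensorMap_apply {R S : SigmaAlg k} (f : R ⟶ S) (x : A ⊗[k] R) :
    (tensorMap A f).toAlgHom x = f.toAlgHom.toLinearMap.lTensor A x := by
  induction x with
  | zero => simp
  | tmul a r =>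
    refine (tensorLift_tmul _ _ a r).trans ?_
    change (a ⊗ₜ[k] (1 : S)) * ((1 : A) ⊗ₜ[k] f.toAlgHom r) = _
    simp
  | add x y hx hy => rw [map_add, map_add, hx, hy]

theorem inclRight_eq : inclRight k A = tensorInr A (of k A) := rfl

theorem inclLeft_eq : inclLeft k A = tensorInl A (of k A) := rfl

theorem face₁_eq : face₁ k A = tensorInr A (tensor A (of k A)) := rfl

/-- With the faces in this form, identities between them follow from the universal property of the
coproduct. -/
theorem face₂_eq : face₂ k A = tensorMap A (tensorInr A (of k A)) := by
  refine tensor_hom_ext (R := of k A) (S := tensor A (tensor A (of k A)))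
    (hom_ext fun a => ?_) (hom_ext fun a => ?_)
  · change (face₂ k A).toAlgHom (a ⊗ₜ[k] 1) = a ⊗ₜ[k] 1 * 1 ⊗ₜ[k] (1 ⊗ₜ[k] 1)
    simp [face₂]
  · change (face₂ k A).toAlgHom (1 ⊗ₜ[k] a) = 1 ⊗ₜ[k] 1 * 1 ⊗ₜ[k] (1 ⊗ₜ[k] a)
    simp [face₂]

theorem face₃_eq : face₃ k A = tensorMap A (tensorInl A (of k A)) := by
  refine tensor_hom_ext (R := of k A) (S := tensor A (tensor A (of k A)))
    (hom_ext fun a => ?_) (hom_ext fun a => ?_)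
  · change (face₃ k A).toAlgHom (a ⊗ₜ[k] 1) = a ⊗ₜ[k] 1 * 1 ⊗ₜ[k] (1 ⊗ₜ[k] 1)
    simp [face₃]
  · change (face₃ k A).toAlgHom (1 ⊗ₜ[k] a) = 1 ⊗ₜ[k] 1 * 1 ⊗ₜ[k] (a ⊗ₜ[k] 1)
    simp [face₃]

/-! ### Faithfully flat descent -/

variable [Module.FaithfullyFlat k A]

theorem tensorMap_injective {R S : SigmaAlg k} {f : R ⟶ S}
    (hf : Function.Injective f.toAlgHom) : Function.Injective (tensorMap A f).toAlgHom := by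
  intro x y h
  rw [tensorMap_apply, tensorMap_apply] at h
  exact Module.Flat.lTensor_preserves_injective_linearMap f.toAlgHom.toLinearMap hf h

theorem tensorInr_injective (R : SigmaAlg k) : Function.Injective (tensorInr A R).toAlgHom :=
  Module.FaithfullyFlat.tensorProduct_mk_injective (B := A) R

/-- Tensoring with the flat module `A` preserves the equalizer of two linear maps. -/
theorem exists_tensorMap_equalizerι {R S : SigmaAlg k} (f g : R ⟶ S) (x : tensor A R)
    (hx : (tensorMap A f).toAlgHom x = (tensorMap A g).toAlgHom x) :
    ∃ y, (tensorMap A (equalizerι f g)).toAlgHom y = x := by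
  have h := Module.Flat.eqLocus_lTensor_eq k A f.toAlgHom.toLinearMap g.toAlgHom.toLinearMap
  rw [tensorMap_apply, tensorMap_apply] at hx
  have hx' : x ∈ LinearMap.eqLocus
      (AlgebraTensorModule.lTensor k A f.toAlgHom.toLinearMap)
      (AlgebraTensorModule.lTensor k A g.toAlgHom.toLinearMap) := hx
  rw [h] at hx'
  obtain ⟨y, hy⟩ := hx'
  exact ⟨y, (tensorMap_apply _ _).trans hy⟩

/-- Faithfully flat descent for algebras: if `ρ : M → A ⊗ M` is a coaction on the `A`-algebra `M`,
then `M` is the base change of the subalgebra of coinvariants. -/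
theorem isIso_lift_equalizerι {M : SigmaAlg k} (i : of k A ⟶ M) (ρ : M ⟶ tensor A M)
    (hi : i ≫ ρ = tensorInl A M) (hcounit : ρ ≫ tensorLift i (𝟙 M) = 𝟙 M)
    (hcoassoc : ρ ≫ tensorMap A ρ = ρ ≫ tensorMap A (tensorInr A M)) :
    IsIso (tensorLift i (equalizerι ρ (tensorInr A M))) := by
  -- On coinvariants `ρ` is `m ↦ 1 ⊗ m`, so following the comparison map by `ρ` gives `A ⊗ ι`, with
  -- `ι` the inclusion of the coinvariants. This is injective by flatness.
  have hc : tensorLift i (equalizerι ρ (tensorInr A M)) ≫ ρ =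
      tensorMap A (equalizerι ρ (tensorInr A M)) := by
    rw [tensorLift_comp, hi, equalizer_condition]
    rfl
  apply isIso_of_bijective
  constructor
  · intro x y h
    apply tensorMap_injective (equalizerι_injective ρ (tensorInr A M))
    rw [← hc, comp_apply, h, comp_apply]
  · intro m
    -- Coassociativity places `ρ m` in `A ⊗` (coinvariants); the counit then cancels `ρ` and
    -- exhibits `m` as an image.
    obtain ⟨y, hy⟩ := exists_tensorMap_equalizerι ρ (tensorInr A M) (ρ.toAlgHom m)
      (congr_apply hcoassoc m)
    refine ⟨y, ?_⟩
    rw [← hc, comp_apply] at hy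
    have h := congrArg (tensorLift i (𝟙 M)).toAlgHom hy
    rwa [← comp_apply ρ, ← comp_apply ρ, hcounit] at h

/-- `R → A ⊗ R ⇉ A ⊗ A ⊗ R` is an equalizer. -/
theorem exists_comp_tensorInr {R S : SigmaAlg k} (f : S ⟶ tensor A R)
    (hf : f ≫ tensorInr A (tensor A R) = f ≫ tensorMap A (tensorInr A R)) :
    ∃ g : S ⟶ R, g ≫ tensorInr A R = f := by
  -- The coaction `a ⊗ r ↦ a ⊗ 1 ⊗ r`. Its coinvariants receive a map `j` from `R`; `A ⊗ j` is
  -- inverse to the comparison isomorphism, so `j` is an isomorphism by faithful flatness.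
  let ρ : tensor A R ⟶ tensor A (tensor A R) := tensorMap A (tensorInr A R)
  have h := isIso_lift_equalizerι (tensorInl A R) ρ (by simp [ρ])
    (by apply tensor_hom_ext <;> simp [ρ]) (by apply tensor_hom_ext <;> simp [ρ])
  let j : R ⟶ equalizer ρ (tensorInr A (tensor A R)) :=
    equalizerLift _ _ (tensorInr A R) (by simp [ρ])
  have hj : tensorMap A j ≫ tensorLift (tensorInl A R) (equalizerι ρ (tensorInr A _)) =
      𝟙 _ := by
    apply tensor_hom_ext
    · simp
    · simp [j, equalizerLift_ι]
  have h1 : IsIso (tensorMap A j) := by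
    rw [← IsIso.eq_comp_inv] at hj
    rw [hj]
    infer_instance
  have h2 : Function.Bijective (tensorMap A j).toAlgHom := by
    refine Function.bijective_iff_has_inverse.2 ⟨(inv (tensorMap A j)).toAlgHom, fun x => ?_,
      fun x => ?_⟩
    · rw [← comp_apply, IsIso.hom_inv_id]; rfl
    · rw [← comp_apply, IsIso.inv_hom_id]; rfl
  have h3 : Function.Bijective j.toAlgHom.toLinearMap := by
    rw [← Module.FaithfullyFlat.lTensor_bijective_iff_bijective k A]
    rwa [show ⇑(j.toAlgHom.toLinearMap.lTensor A) = (tensorMap A j).toAlgHom from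
      funext fun x => (tensorMap_apply _ _).symm]
  have h4 : IsIso j := isIso_of_bijective j h3
  refine ⟨equalizerLift _ _ f hf.symm ≫ inv j, ?_⟩
  have h5 : inv j ≫ tensorInr A R = equalizerι _ _ := by
    rw [IsIso.inv_comp_eq]
    rfl
  rw [Category.assoc, h5, equalizerLift_ι]

/-- Finite `σ`-generation descends along faithfully flat base change. -/
theorem FinitelyGenerated.of_tensor_iso {B C : SigmaAlg k} (hB : B.FinitelyGenerated)
    (e : tensor A C ≅ tensor A B) (he : tensorInl A C ≫ e.hom = tensorInl A B) :
    C.FinitelyGenerated := by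
  classical
  obtain ⟨s, hs⟩ := hB
  let w : B ⟶ tensor A C := tensorInr A B ≫ e.inv
  have he' : tensorInl A B ≫ e.inv = tensorInl A C := by rw [Iso.comp_inv_eq, he]
  -- An element of `A ⊗ C` is a finite sum of pure tensors, so it involves only finitely many
  -- elements of `C`.
  have key : ∀ x : A ⊗[k] C, ∃ t : Finset C, ∀ S : Subalgebra k C, (t : Set C) ⊆ S →
      x ∈ LinearMap.range (S.val.toLinearMap.lTensor A) := by
    intro x
    induction x with
    | zero => exact ⟨∅, fun S _ => zero_mem _⟩
    | tmul a c =>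
      exact ⟨{c}, fun S hS => ⟨a ⊗ₜ ⟨c, hS (by simp)⟩, rfl⟩⟩
    | add x y hx hy =>
      obtain ⟨t, ht⟩ := hx
      obtain ⟨t', ht'⟩ := hy
      refine ⟨t ∪ t', fun S hS => add_mem (ht S fun c hc => hS ?_) (ht' S fun c hc => hS ?_)⟩
      · exact Finset.mem_coe.2 (Finset.mem_union_left _ hc)
      · exact Finset.mem_coe.2 (Finset.mem_union_right _ hc)
  choose t ht using key
  refine ⟨s.biUnion fun b => t (w.toAlgHom b), fun S hS hσ => ?_⟩
  -- The image of `A ⊗ S` is a `σ`-stable subalgebra. It contains `a ⊗ 1` and the images of the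
  -- generators of `B`, hence everything; faithful flatness then gives `S = C`.
  let P : Subalgebra k (A ⊗[k] C) :=
    (Algebra.TensorProduct.map (AlgHom.id k A) S.val).range
  have hPσ : ∀ x ∈ P, SigmaRing.sigma x ∈ P := by
    rintro _ ⟨y, rfl⟩
    change A ⊗[k] S at y
    induction y with
    | zero => simp
    | tmul a c =>
      exact ⟨SigmaRing.sigma a ⊗ₜ ⟨_, hσ c.1 c.2⟩, by simp [sigma_tmul]⟩
    | add x y hx hy =>
      simp only [map_add]
      exact add_mem hx hy
  have h1 : P.comap w.toAlgHom = ⊤ := by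
    refine hs _ (fun b hb => ?_) fun b hb => ?_
    · refine ht _ S fun c hc => hS ?_
      exact Finset.mem_coe.2 (Finset.mem_biUnion.2 ⟨b, hb, hc⟩)
    · change w.toAlgHom _ ∈ P
      rw [w.map_sigma]
      exact hPσ _ hb
  have h2 : ∀ x : A ⊗[k] B, e.inv.toAlgHom x ∈ P := by
    intro x
    induction x with
    | zero => rw [map_zero]; exact zero_mem _
    | tmul a b =>
      rw [← mul_one a, ← one_mul b, ← Algebra.TensorProduct.tmul_mul_tmul, map_mul]
      refine mul_mem ?_ (h1.ge (Algebra.mem_top (x := b)))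
      have : e.inv.toAlgHom (a ⊗ₜ[k] 1) = a ⊗ₜ[k] 1 := congr_apply he' a
      rw [this]
      exact ⟨a ⊗ₜ 1, by simp⟩
    | add x y hx hy => rw [map_add]; exact add_mem hx hy
  have h3 : Function.Surjective (S.val.toLinearMap.lTensor A) := by
    intro x
    have h := h2 (e.hom.toAlgHom x)
    rw [← comp_apply, e.hom_inv_id] at h
    exact h
  rw [Module.FaithfullyFlat.lTensor_surjective_iff_surjective] at h3
  refine Algebra.eq_top_iff.2 fun c => ?_
  obtain ⟨d, rfl⟩ := h3 c
  exact d.2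

end Tensor

end SigmaAlg

/-! ### The sheaf condition for `σ`-varieties along `R → A ⊗ R` -/

section Points

open SigmaAlg

variable {k : Type u} [CommRing k] [SigmaRing k]

theorem SigmaAlgebraicGroup.map_comp_apply (G : SigmaAlgebraicGroup k) {R S T : SigmaAlg k}
    (f : R ⟶ S) (g : S ⟶ T) (x : G.points.obj R) :
    G.points.map (f ≫ g) x = G.points.map g (G.points.map f x) := by
  rw [G.points.map_comp]; rfl

theorem points_map_comp_apply (X : SigmaAlg k ⥤ Type u) {R S T : SigmaAlg k}
    (f : R ⟶ S) (g : S ⟶ T) (x : X.obj R) :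
    X.map (f ≫ g) x = X.map g (X.map f x) := by
  rw [X.map_comp]; rfl

theorem points_map_id_apply (X : SigmaAlg k ⥤ Type u) {R : SigmaAlg k} (x : X.obj R) :
    X.map (𝟙 R) x = x := by
  rw [X.map_id]; rfl

/-- A universal point corepresents the functor. -/
noncomputable def corepresentableByOfUniversal {X : SigmaAlg k ⥤ Type u} {B : SigmaAlg k}
    (u : X.obj B) (hu : ∀ (R : SigmaAlg k) (y : X.obj R), ∃! f : B ⟶ R, X.map f u = y) :
    X.CorepresentableBy B where
  homEquiv {R} := Equiv.ofBijective (fun f => X.map f u)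
    ⟨fun _ g h => (hu R (X.map g u)).unique h rfl, fun y => (hu R y).exists⟩
  homEquiv_comp g f := points_map_comp_apply X f g u

theorem IsSigmaVariety.exists_universal {X : SigmaAlg k ⥤ Type u} (hX : IsSigmaVariety X) :
    ∃ (B : SigmaAlg k) (u : X.obj B), B.FinitelyGenerated ∧
      ∀ (R : SigmaAlg k) (y : X.obj R), ∃! f : B ⟶ R, X.map f u = y := by
  obtain ⟨B, hB, ⟨r⟩⟩ := hX
  refine ⟨B, r.homEquiv (𝟙 B), hB, fun R y => ⟨r.homEquiv.symm y, ?_, fun f hf => ?_⟩⟩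
  · change X.map _ _ = y
    rw [← r.homEquiv_eq, Equiv.apply_symm_apply]
  · change X.map f _ = y at hf
    rw [← r.homEquiv_eq] at hf
    rw [← hf, Equiv.symm_apply_apply]

variable (A : Type u) [CommRing A] [SigmaRing A] [Algebra k A] [SigmaAlgebra k A]
  [Module.FaithfullyFlat k A]

/-- Points are morphisms out of a representing algebra, and `R → A ⊗ R` is injective. -/
theorem IsSigmaVariety.map_tensorInr_injective {X : SigmaAlg k ⥤ Type u} (hX : IsSigmaVariety X)
    (R : SigmaAlg k) : Function.Injective (X.map (tensorInr A R)) := by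
  obtain ⟨B, u, -, hu⟩ := hX.exists_universal
  intro x y h
  obtain ⟨f, rfl, -⟩ := hu R x
  obtain ⟨g, rfl, -⟩ := hu R y
  rw [← points_map_comp_apply, ← points_map_comp_apply] at h
  have h' := (hu _ _).unique h rfl
  have : f = g := SigmaAlg.hom_ext fun b => tensorInr_injective (A := A) R (congr_apply h' b)
  rw [this]

/-- The gluing half of the sheaf condition: a morphism from the representing algebra to `A ⊗ R` that
equalizes the two maps to `A ⊗ A ⊗ R` factors through `R`. -/
theorem IsSigmaVariety.exists_map_tensorInr {X : SigmaAlg k ⥤ Type u} (hX : IsSigmaVariety X)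
    {R : SigmaAlg k} (x : X.obj (tensor A R))
    (hx : X.map (tensorInr A (tensor A R)) x = X.map (tensorMap A (tensorInr A R)) x) :
    ∃ y, X.map (tensorInr A R) y = x := by
  obtain ⟨B, u, -, hu⟩ := hX.exists_universal
  obtain ⟨f, rfl, -⟩ := hu _ x
  rw [← points_map_comp_apply, ← points_map_comp_apply] at hx
  obtain ⟨g, rfl⟩ := exists_comp_tensorInr f ((hu _ _).unique hx rfl)
  exact ⟨X.map g u, (points_map_comp_apply X g _ u).symm⟩

end Points

/-! ### The twist of `G` by a cocycle -/

section Twist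

open SigmaAlg

variable {k : Type u} [CommRing k] [SigmaRing k]
  {A : Type u} [CommRing A] [SigmaRing A] [Algebra k A] [SigmaAlgebra k A]
  {G : SigmaAlgebraicGroup k}

/-- The condition that cuts out the `R`-points of the twist of `G` by `χ` in `G(A ⊗ R)`. -/
def IsTwistedPoint (χ : G.points.obj (tensor A (of k A))) {R : SigmaAlg k}
    (g : G.points.obj (tensor A R)) : Prop :=
  G.points.map (tensorMap A (tensorInr A R)) g =
    G.points.map (tensorInr A (tensor A R)) g * G.points.map (tensorMap A (tensorInl A R)) χ

theorem IsTwistedPoint.map {χ : G.points.obj (tensor A (of k A))} {R S : SigmaAlg k}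
    {g : G.points.obj (tensor A R)} (hg : IsTwistedPoint χ g) (f : R ⟶ S) :
    IsTwistedPoint χ (G.points.map (tensorMap A f) g) := by
  have h := congrArg (G.points.map (tensorMap A (tensorMap A f))) hg
  rw [map_mul] at h
  simp only [← G.map_comp_apply, ← tensorMap_comp, tensorInr_map, tensorInl_map] at h
  unfold IsTwistedPoint
  simpa only [← G.map_comp_apply, ← tensorMap_comp, tensorInr_map] using h

/-- An element of `G(R)` has equal pullbacks to `A ⊗ A ⊗ R`, and `χ` enters on the right, so left
translation does not disturb the condition. -/
theorem IsTwistedPoint.smul {χ : G.points.obj (tensor A (of k A))} {R : SigmaAlg k}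
    {g : G.points.obj (tensor A R)} (hg : IsTwistedPoint χ g) (h : G.points.obj R) :
    IsTwistedPoint χ (G.points.map (tensorInr A R) h * g) := by
  unfold IsTwistedPoint at hg ⊢
  rw [map_mul, map_mul, hg, ← G.map_comp_apply, ← G.map_comp_apply, tensorInr_map, mul_assoc]

/-- The twist of `G` by a cocycle. -/
noncomputable def twist (χ : G.points.obj (tensor A (of k A))) : GFunctor G.points where
  points :=
    { obj R := {g : G.points.obj (tensor A R) // IsTwistedPoint χ g}
      map {R S} f := TypeCat.ofHom fun g => ⟨G.points.map (tensorMap A f) g.1, g.2.map f⟩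
      map_id R := by
        ext g
        change G.points.map (tensorMap A (𝟙 R)) g.1 = g.1
        rw [show tensorMap A (𝟙 R) = 𝟙 _ by apply tensor_hom_ext <;> simp, G.points.map_id]
        rfl
      map_comp f f' := by
        ext g
        change G.points.map (tensorMap A (f ≫ f')) g.1 = _
        rw [tensorMap_comp, G.map_comp_apply]
        rfl }
  mulAction R :=
    { smul h g := ⟨G.points.map (tensorInr A R) h * g.1, g.2.smul h⟩
      one_smul g := Subtype.ext (by
        change G.points.map (tensorInr A R) 1 * g.1 = g.1
        rw [map_one, one_mul])
      mul_smul h h' g := Subtype.ext (by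
        change G.points.map (tensorInr A R) (h * h') * g.1 = _ * (_ * g.1)
        rw [map_mul, mul_assoc]) }
  map_smul {R S} f h g := Subtype.ext (by
    change G.points.map (tensorMap A f) (G.points.map (tensorInr A R) h * g.1) =
      G.points.map (tensorInr A S) (G.points.map f h) * G.points.map (tensorMap A f) g.1
    rw [map_mul, ← G.map_comp_apply, ← G.map_comp_apply, tensorInr_map])

/-- The case `R = A` of the twisting condition: a cocycle is an `A`-point of its own twist, and this
point will trivialize the twist. -/
theorem isCocycle_iff (χ : G.points.obj (tensor A (of k A))) :
    IsCocycle χ ↔ IsTwistedPoint χ χ := by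
  unfold IsCocycle IsTwistedPoint
  rw [← face₂_eq, ← face₁_eq, ← face₃_eq]

/-- A cocycle restricts to `1` along the multiplication `A ⊗ A → A`. -/
theorem map_lift_eq_one {χ : G.points.obj (tensor A (of k A))} (hχ : IsTwistedPoint χ χ)
    {S : SigmaAlg k} (f : of k A ⟶ S) : G.points.map (tensorLift f f) χ = 1 := by
  -- Along `a ⊗ b ⊗ c ↦ f a * f b * f c` the three faces of `χ` coincide, so the cocycle condition
  -- reads `e = e * e`.
  have h := congrArg (G.points.map (tensorLift f (tensorLift f f))) hχ
  rw [map_mul] at h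
  simp only [← G.map_comp_apply, tensorMap_lift, tensorInr_lift, tensorInl_lift] at h
  exact left_eq_mul.1 h

variable [Module.FaithfullyFlat k A]

/-- Freeness is the injectivity of `G(R) → G(A ⊗ R)`. For transitivity, `χ` cancels in `y * x⁻¹`,
whose two pullbacks therefore agree, so it descends to `G(R)`. -/
theorem twist_bijective (χ : G.points.obj (tensor A (of k A))) (R : SigmaAlg k) :
    Function.Bijective (fun p : G.points.obj R × (twist χ).points.obj R => (p.1 • p.2, p.2)) := by
  constructor
  · rintro ⟨g, x⟩ ⟨h, y⟩ e
    obtain ⟨e1, rfl⟩ := Prod.mk.inj e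
    have e2 : G.points.map (tensorInr A R) g * x.1 = G.points.map (tensorInr A R) h * x.1 :=
      congrArg Subtype.val e1
    rw [G.isSigmaVariety.map_tensorInr_injective A R (mul_right_cancel e2)]
  · rintro ⟨y, x⟩
    obtain ⟨g, hg⟩ := G.isSigmaVariety.exists_map_tensorInr A (R := R)
      (show G.points.obj (tensor A R) from y.1 * x.1⁻¹) (by
        change G.points.map _ (y.1 * x.1⁻¹) = G.points.map _ (y.1 * x.1⁻¹)
        have hx : IsTwistedPoint χ x.1 := x.2
        have hy : IsTwistedPoint χ y.1 := y.2
        unfold IsTwistedPoint at hx hy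
        rw [map_mul, map_mul, map_inv, map_inv, hx, hy]
        group)
    refine ⟨(g, x), Prod.ext (Subtype.ext ?_) rfl⟩
    change G.points.map (tensorInr A R) g * x.1 = y.1
    rw [show G.points.map (tensorInr A R) g = y.1 * x.1⁻¹ from hg, inv_mul_cancel_right]

/-- Right translation by `χ` turns `A ⊗ B` into a comodule algebra, and its coinvariants represent
the twist: a twisted point over `R` is an `A`-linear morphism `A ⊗ B → A ⊗ R` respecting the
coactions, which amounts to a morphism from the coinvariants to `R`. -/
theorem twist_isSigmaVariety {χ : G.points.obj (tensor A (of k A))} (hχ : IsTwistedPoint χ χ) :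
    IsSigmaVariety (twist χ).points := by
  obtain ⟨B, u, hB, hu'⟩ := G.isSigmaVariety.exists_universal
  change G.points.obj B at u
  have hu : ∀ (R : SigmaAlg k) (y : G.points.obj R), ∃! f : B ⟶ R, G.points.map f u = y := hu'
  have hinj : ∀ {R : SigmaAlg k} {f g : B ⟶ R},
      G.points.map f u = G.points.map g u → f = g := fun h => (hu _ _).unique h rfl
  -- the coaction on `A ⊗ B` dual to `g ↦ g * χ`
  obtain ⟨θ, hθ, -⟩ := hu (tensor A (tensor A B))
    (G.points.map (tensorInr A B ≫ tensorInr A (tensor A B)) u *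
      G.points.map (tensorMap A (tensorInl A B)) χ)
  let ρ : tensor A B ⟶ tensor A (tensor A B) := tensorLift (tensorInl A (tensor A B)) θ
  have hρ1 : ρ ≫ tensorLift (tensorInl A B) (𝟙 (tensor A B)) = 𝟙 (tensor A B) := by
    apply tensor_hom_ext
    · simp [ρ]
    · apply hinj
      simp only [ρ, tensorInr_lift_assoc, Category.comp_id]
      rw [G.map_comp_apply, hθ, map_mul, ← G.map_comp_apply, ← G.map_comp_apply, tensorMap_lift,
        Category.comp_id, map_lift_eq_one hχ]
      simp
  have hρ2 : ρ ≫ tensorMap A ρ = ρ ≫ tensorMap A (tensorInr A (tensor A B)) := by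
    apply tensor_hom_ext
    · simp [ρ]
    · apply hinj
      simp only [ρ, tensorInr_lift_assoc]
      rw [G.map_comp_apply, G.map_comp_apply, hθ, map_mul, map_mul]
      simp only [← G.map_comp_apply, ← tensorMap_comp, Category.assoc, tensorInr_map,
        tensorInl_lift, tensorInr_lift_assoc]
      rw [G.map_comp_apply, hθ, map_mul, ← G.map_comp_apply]
      -- Coassociativity on the universal point is the cocycle condition pushed forward to `A ⊗ A ⊗
      -- A ⊗ B`.
      have h := congrArg
        (G.points.map (tensorMap A (tensorMap A (tensorInl A B)))) hχ
      rw [map_mul] at h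
      simp only [← G.map_comp_apply, ← tensorMap_comp, tensorInr_map, tensorInl_map] at h
      rw [h, ← G.map_comp_apply, Category.assoc, mul_assoc]
  have hiso := isIso_lift_equalizerι (tensorInl A B) ρ (tensorInl_lift _ _) hρ1 hρ2
  let C := equalizer ρ (tensorInr A (tensor A B))
  let ι : C ⟶ tensor A B := equalizerι ρ (tensorInr A (tensor A B))
  let c : tensor A C ⟶ tensor A B := tensorLift (tensorInl A B) ι
  have hc : IsIso c := hiso
  have hcl : tensorInl A C ≫ c = tensorInl A B := tensorInl_lift _ _
  have hcl' : tensorInl A B ≫ inv c = tensorInl A C := by rw [IsIso.comp_inv_eq, hcl]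
  have hιρ : ι ≫ ρ = ι ≫ tensorInr A (tensor A B) := equalizer_condition _ _
  have hcρ : c ≫ ρ = tensorMap A ι := by
    rw [tensorLift_comp, hιρ]
    congr 1
    exact tensorInl_lift _ _
  -- the universal point
  have hξ : IsTwistedPoint χ (G.points.map (tensorInr A B ≫ inv c) u) := by
    -- It suffices to check the condition after applying the isomorphism `A ⊗ c`, where it becomes
    -- the defining equation `hθ`.
    have hmono : IsIso (tensorMap A c) := by
      refine ⟨tensorMap A (inv c), ?_, ?_⟩ <;> rw [← tensorMap_comp] <;>
        simp only [IsIso.hom_inv_id, IsIso.inv_hom_id] <;> apply tensor_hom_ext <;> simp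
    have hGinj : Function.Injective (G.points.map (tensorMap A c)) :=
      Function.LeftInverse.injective (g := G.points.map (inv (tensorMap A c))) fun x => by
        rw [← G.map_comp_apply, IsIso.hom_inv_id, G.points.map_id]; rfl
    apply hGinj
    rw [map_mul]
    simp only [← G.map_comp_apply, ← tensorMap_comp, Category.assoc, tensorInr_map,
      IsIso.inv_hom_id_assoc, hcl]
    rw [show tensorInr A C ≫ c = ι from tensorInr_lift _ _, ← hcρ, IsIso.inv_hom_id_assoc,
      show tensorInr A B ≫ ρ = θ from tensorInr_lift _ _, hθ]
  refine ⟨C, hB.of_tensor_iso (asIso c) hcl, ⟨corepresentableByOfUniversal ⟨_, hξ⟩ ?_⟩⟩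
  rintro R ⟨y, hy⟩
  obtain ⟨g, rfl, -⟩ := hu _ y
  let g' : tensor A B ⟶ tensor A R := tensorLift (tensorInl A R) g
  have hg1 : tensorInr A B ≫ g' = g := tensorInr_lift _ _
  -- The twisting condition `hy` says that `g'` intertwines `ρ` with `a ⊗ r ↦ a ⊗ 1 ⊗ r`; hence `g'`
  -- carries coinvariants into `R`.
  have hg2 : g' ≫ tensorMap A (tensorInr A R) = ρ ≫ tensorMap A g' := by
    apply tensor_hom_ext
    · simp [g', ρ]
    · apply hinj
      rw [← Category.assoc, hg1, G.map_comp_apply, hy, ← Category.assoc,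
        show tensorInr A B ≫ ρ = θ from tensorInr_lift _ _, G.map_comp_apply θ, hθ, map_mul]
      simp only [← G.map_comp_apply, ← tensorMap_comp, Category.assoc, tensorInr_map]
      rw [← Category.assoc, hg1]
      simp [g']
  obtain ⟨f, hf⟩ := exists_comp_tensorInr (ι ≫ g') (by
    rw [Category.assoc, Category.assoc, hg2, ← Category.assoc ι ρ, hιρ, Category.assoc,
      tensorInr_map])
  have hf' : tensorMap A f = c ≫ g' := by
    rw [tensorLift_comp, ← hf]
    apply tensor_hom_ext
    · simp [g']
    · simp
  refine ⟨f, Subtype.ext ?_, fun f' hf'' => ?_⟩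
  · change G.points.map (tensorMap A f) (G.points.map (tensorInr A B ≫ inv c) u) = _
    rw [← G.map_comp_apply, hf', Category.assoc, IsIso.inv_hom_id_assoc, hg1]
  · have h1 : G.points.map (tensorMap A f') (G.points.map (tensorInr A B ≫ inv c) u) =
        G.points.map g u := congrArg Subtype.val hf''
    rw [← G.map_comp_apply] at h1
    -- The point determines `A ⊗ f'`, and this determines `f'` because `R → A ⊗ R` is injective.
    have h2 : inv c ≫ tensorMap A f' = g' := by
      apply tensor_hom_ext
      · rw [← Category.assoc, hcl']; simp [g']
      · rw [← Category.assoc, hg1]; exact hinj h1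
    have h3 : tensorMap A f' = tensorMap A f := by
      rw [hf', ← h2, IsIso.hom_inv_id_assoc]
    have h4 : f' ≫ tensorInr A R = f ≫ tensorInr A R := by
      rw [← tensorInr_map, h3, tensorInr_map]
    exact SigmaAlg.hom_ext fun b => tensorInr_injective (A := A) R (congr_apply h4 b)

end Twist

/-! ### Torsors and their difference cocycles -/

namespace SigmaTorsor

open SigmaAlg

section Points

variable {k : Type u} [CommRing k] [SigmaRing k] {G : SigmaAlgebraicGroup k} (X : SigmaTorsor G)

theorem smul_right_cancel {R : SigmaAlg k} {g h : G.points.obj R} {x : X.points.obj R}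
    (e : g • x = h • x) : g = h :=
  congrArg Prod.fst ((X.bijective R).1 (a₁ := (g, x)) (a₂ := (h, x)) (Prod.ext e rfl))

theorem exists_smul_eq {R : SigmaAlg k} (x y : X.points.obj R) :
    ∃ g : G.points.obj R, g • x = y := by
  obtain ⟨⟨g, x'⟩, h⟩ := (X.bijective R).2 (y, x)
  obtain ⟨h1, rfl⟩ := Prod.mk.inj h
  exact ⟨g, h1⟩

end Points

section Cocycle

variable {k : Type u} [CommRing k] [SigmaRing k]
  {A : Type u} [CommRing A] [SigmaRing A] [Algebra k A] [SigmaAlgebra k A]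
  {G : SigmaAlgebraicGroup k}

/-- `χ` is the difference of the two pullbacks of `x` to `A ⊗ A`. -/
def IsDifference (X : SigmaTorsor G) (x : X.points.obj (of k A))
    (χ : G.points.obj (of k (A ⊗[k] A))) : Prop :=
  X.points.map (inclRight k A) x = χ • X.points.map (inclLeft k A) x

/-- Let `x₁, x₂, x₃` be the pullbacks of `x` to `A ⊗ A ⊗ A`. Then `∂₃ χ` takes `x₁` to `x₂`, `∂₁ χ`
takes `x₂` to `x₃`, and `∂₂ χ` takes `x₁` to `x₃`; freeness of the action gives the cocycle
condition. -/
theorem IsDifference.isCocycle {X : SigmaTorsor G} {x : X.points.obj (of k A)}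
    {χ : G.points.obj (of k (A ⊗[k] A))} (h : X.IsDifference x χ) : IsCocycle χ := by
  have h1 := congrArg (X.points.map (face₁ k A)) h
  have h2 := congrArg (X.points.map (face₂ k A)) h
  have h3 := congrArg (X.points.map (face₃ k A)) h
  have e1 : inclRight k A ≫ face₁ k A = inclRight k A ≫ face₂ k A := by
    rw [face₂_eq, face₁_eq]; exact (tensorInr_map _).symm
  have e2 : inclLeft k A ≫ face₁ k A = inclRight k A ≫ face₃ k A := by
    rw [face₁_eq, face₃_eq]; exact (tensorInr_map _).symm
  have e3 : inclLeft k A ≫ face₂ k A = inclLeft k A ≫ face₃ k A := by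
    rw [face₂_eq, face₃_eq]; exact (tensorInl_map _).trans (tensorInl_map _).symm
  rw [X.map_smul, ← points_map_comp_apply, ← points_map_comp_apply] at h1 h2 h3
  rw [← e1, e3] at h2
  rw [e2, h3, smul_smul, h2] at h1
  exact X.smul_right_cancel h1

theorem exists_isDifference (X : SigmaTorsor G) (x : X.points.obj (of k A)) :
    ∃ χ : Cocycle A G, X.IsDifference x χ.1 := by
  obtain ⟨χ, h⟩ := X.exists_smul_eq (X.points.map (inclLeft k A) x)
    (X.points.map (inclRight k A) x)
  have h' : X.IsDifference x χ := h.symm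
  exact ⟨⟨χ, h'.isCocycle⟩, h'⟩

theorem IsDifference.smul {X : SigmaTorsor G} {x : X.points.obj (of k A)}
    {χ : G.points.obj (of k (A ⊗[k] A))} (h : X.IsDifference x χ)
    (α : G.points.obj (of k A)) : X.IsDifference (α • x)
      (G.points.map (inclRight k A) α * χ * (G.points.map (inclLeft k A) α)⁻¹) := by
  unfold IsDifference at h ⊢
  rw [X.map_smul, X.map_smul, h, smul_smul, smul_smul, inv_mul_cancel_right]

theorem IsDifference.map {X Y : SigmaTorsor G} (i : GFunctor.Iso X.toGFunctor Y.toGFunctor)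
    {x : X.points.obj (of k A)} {χ : G.points.obj (of k (A ⊗[k] A))} (h : X.IsDifference x χ) :
    Y.IsDifference (i.iso.hom.app _ x) χ := by
  unfold IsDifference at h ⊢
  rw [← NatTrans.naturality_apply, ← NatTrans.naturality_apply, h, i.map_smul]

theorem equivalent_of_isDifference {X : SigmaTorsor G} {x y : X.points.obj (of k A)}
    {χ ψ : Cocycle A G} (hx : X.IsDifference x χ.1) (hy : X.IsDifference y ψ.1) :
    H1.mk χ = H1.mk ψ := by
  obtain ⟨α, rfl⟩ := X.exists_smul_eq y x
  refine Quotient.sound ⟨α, X.smul_right_cancel (hx.symm.trans (hy.smul α))⟩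

/-- Translating `x` by the element that realizes the equivalence yields the required point. -/
theorem exists_isDifference_of_equivalent {X : SigmaTorsor G} {x : X.points.obj (of k A)}
    {χ ψ : Cocycle A G} (hx : X.IsDifference x χ.1) (h : H1.mk ψ = H1.mk χ) :
    ∃ y, X.IsDifference y ψ.1 := by
  obtain ⟨α, hα⟩ : ψ ≈ χ := Quotient.exact h
  exact ⟨α • x, by rw [hα]; exact hx.smul α⟩

variable (A) in
/-- Let `x` and `y` be points over `A` of two torsors with the same difference cocycle. If `z` is an
`R`-point that equals `g • x` over `A ⊗ R`, then `g • y` descends to an `R`-point. -/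
theorem exists_transport [Module.FaithfullyFlat k A] {X Y : SigmaTorsor G}
    {x : X.points.obj (of k A)} {y : Y.points.obj (of k A)} {χ : G.points.obj (of k (A ⊗[k] A))}
    (hx : X.IsDifference x χ) (hy : Y.IsDifference y χ) (R : SigmaAlg k) (z : X.points.obj R) :
    ∃ (w : Y.points.obj R) (g : G.points.obj (tensor A R)),
      X.points.map (tensorInr A R) z = g • X.points.map (tensorInl A R) x ∧
      Y.points.map (tensorInr A R) w = g • Y.points.map (tensorInl A R) y := by
  obtain ⟨g, hg⟩ := X.exists_smul_eq (X.points.map (tensorInl A R) x)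
    (X.points.map (tensorInr A R) z)
  -- Both pullbacks of `g • v` to `A ⊗ A ⊗ R` are multiples of one and the same pullback of `v`,
  -- with coefficients that depend only on `g` and `χ`.
  have descend : ∀ {Z : SigmaTorsor G} {v : Z.points.obj (of k A)}, Z.IsDifference v χ →
      Z.points.map (tensorInr A (tensor A R)) (g • Z.points.map (tensorInl A R) v) =
        (G.points.map (tensorInr A (tensor A R)) g *
          G.points.map (tensorMap A (tensorInl A R)) χ) •
          Z.points.map (tensorInl A (tensor A R)) v ∧
      Z.points.map (tensorMap A (tensorInr A R)) (g • Z.points.map (tensorInl A R) v) =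
        G.points.map (tensorMap A (tensorInr A R)) g •
          Z.points.map (tensorInl A (tensor A R)) v := by
    intro Z v hv
    have h := congrArg (Z.points.map (tensorMap A (tensorInl A R))) hv
    rw [Z.map_smul, ← points_map_comp_apply, ← points_map_comp_apply, inclRight_eq, inclLeft_eq,
      tensorInr_map, tensorInl_map] at h
    rw [Z.map_smul, Z.map_smul, ← points_map_comp_apply, ← points_map_comp_apply, h, smul_smul,
      tensorInl_map]
    exact ⟨rfl, rfl⟩
  obtain ⟨hx1, hx2⟩ := descend hx
  obtain ⟨hy1, hy2⟩ := descend hy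
  -- As `g • x` comes from `z`, freeness on `X` equates the two coefficients. The equation no longer
  -- involves `X`, so it applies to `Y`.
  have key : G.points.map (tensorInr A (tensor A R)) g *
      G.points.map (tensorMap A (tensorInl A R)) χ =
        G.points.map (tensorMap A (tensorInr A R)) g := by
    apply X.smul_right_cancel (x := X.points.map (tensorInl A (tensor A R)) x)
    rw [← hx1, ← hx2, hg, ← points_map_comp_apply, ← points_map_comp_apply, tensorInr_map]
  obtain ⟨w, hw⟩ := Y.isSigmaVariety.exists_map_tensorInr A (R := R)
    (g • Y.points.map (tensorInl A R) y) (by rw [hy1, hy2, key])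
  exact ⟨w, g, hg.symm, hw⟩

/-- The transport `z ↦ w` is single valued: `z` determines `g` by freeness, and `g` determines `w`
since `Y(R) → Y(A ⊗ R)` is injective. This uniqueness (`uniq`) also yields the inverse, naturality
and equivariance. -/
theorem nonempty_iso_of_isDifference [Module.FaithfullyFlat k A] {X Y : SigmaTorsor G}
    {x : X.points.obj (of k A)} {y : Y.points.obj (of k A)} {χ : G.points.obj (of k (A ⊗[k] A))}
    (hx : X.IsDifference x χ) (hy : Y.IsDifference y χ) :
    Nonempty (GFunctor.Iso X.toGFunctor Y.toGFunctor) := by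
  have uniq : ∀ {Z W : SigmaTorsor G} {z : Z.points.obj (of k A)} {w : W.points.obj (of k A)}
      {R : SigmaAlg k} {a : Z.points.obj R} {b b' : W.points.obj R}
      {g g' : G.points.obj (tensor A R)},
      Z.points.map (tensorInr A R) a = g • Z.points.map (tensorInl A R) z →
      W.points.map (tensorInr A R) b = g • W.points.map (tensorInl A R) w →
      Z.points.map (tensorInr A R) a = g' • Z.points.map (tensorInl A R) z →
      W.points.map (tensorInr A R) b' = g' • W.points.map (tensorInl A R) w → b = b' := by
    intro Z W z w R a b b' g g' h1 h2 h3 h4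
    obtain rfl := Z.smul_right_cancel (h1.symm.trans h3)
    exact W.isSigmaVariety.map_tensorInr_injective A R (h2.trans h4.symm)
  choose f hf using exists_transport A hx hy
  choose f' hf' using exists_transport A hy hx
  refine ⟨⟨NatIso.ofComponents (fun R => Equiv.toIso ⟨f R, f' R, fun z => ?_, fun w => ?_⟩)
    (fun {R S} φ => ?_), fun R g z => ?_⟩⟩
  · obtain ⟨g, h1, h2⟩ := hf R z
    obtain ⟨g', h3, h4⟩ := hf' R (f R z)
    exact uniq h3 h4 h2 h1
  · obtain ⟨g, h1, h2⟩ := hf' R w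
    obtain ⟨g', h3, h4⟩ := hf R (f' R w)
    exact uniq h3 h4 h2 h1
  · ext z
    change f S (X.points.map φ z) = Y.points.map φ (f R z)
    obtain ⟨g, h1, h2⟩ := hf S (X.points.map φ z)
    obtain ⟨g', h3, h4⟩ := hf R z
    have base : ∀ {Z : SigmaTorsor G} {v : Z.points.obj (of k A)} {a : Z.points.obj R},
        Z.points.map (tensorInr A R) a = g' • Z.points.map (tensorInl A R) v →
        Z.points.map (tensorInr A S) (Z.points.map φ a) =
          G.points.map (tensorMap A φ) g' • Z.points.map (tensorInl A S) v := by
      intro Z v a h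
      have h := congrArg (Z.points.map (tensorMap A φ)) h
      rwa [Z.map_smul, ← points_map_comp_apply, ← points_map_comp_apply, tensorInr_map,
        tensorInl_map, points_map_comp_apply] at h
    exact uniq h1 h2 (base h3) (base h4)
  · change f R (g • z) = g • f R z
    obtain ⟨h, h1, h2⟩ := hf R (g • z)
    obtain ⟨h', h3, h4⟩ := hf R z
    refine uniq h1 h2 (g' := G.points.map (tensorInr A R) g * h') ?_ ?_
    · rw [X.map_smul, h3, smul_smul]
    · rw [Y.map_smul, h4, smul_smul]

end Cocycle

/-! ### Trivializations, points and descent data -/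

section BaseChange

variable {k : Type u} [CommRing k] [SigmaRing k]
  {A : Type u} [CommRing A] [SigmaRing A] [Algebra k A] [SigmaAlgebra k A]
  {G : SigmaAlgebraicGroup k}

/-- The structure map `A → S` of an `A`-`σ`-algebra, as a morphism of `k`-`σ`-algebras. -/
def scalarMap (k : Type u) [CommRing k] [SigmaRing k]
    {A : Type u} [CommRing A] [SigmaRing A] [Algebra k A] [SigmaAlgebra k A] (S : SigmaAlg A) :
    of k A ⟶ (restrict (SigmaRingHom.ofAlgebra k A)).obj S where
  toAlgHom :=
    { toRingHom := algebraMap A S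
      commutes' := fun _ => rfl }
  map_sigma := SigmaAlgebra.algebraMap_sigma (k := A) (R := S)

theorem scalarMap_comp {S T : SigmaAlg A} (f : S ⟶ T) :
    scalarMap k S ≫ (restrict (SigmaRingHom.ofAlgebra k A)).map f = scalarMap k T :=
  SigmaAlg.hom_ext fun a => f.toAlgHom.commutes a

instance sigmaAlgebraSelf (A : Type u) [CommRing A] [SigmaRing A] : SigmaAlgebra A A :=
  ⟨fun _ => rfl⟩

/-- The restriction to `k` of the `A`-`σ`-algebra `A` is `A` with its given `k`-algebra structure. -/
def restrictSelf (k : Type u) [CommRing k] [SigmaRing k]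
    (A : Type u) [CommRing A] [SigmaRing A] [Algebra k A] [SigmaAlgebra k A] :
    (restrict (SigmaRingHom.ofAlgebra k A)).obj (of A A) ⟶ of k A where
  toAlgHom :=
    { toRingHom := RingHom.id A
      commutes' := fun _ => rfl }
  map_sigma _ := rfl

/-- The structure map of an `A`-`σ`-algebra. -/
def ofSelf (S : SigmaAlg A) : of A A ⟶ S where
  toAlgHom := Algebra.ofId A S
  map_sigma := SigmaAlgebra.algebraMap_sigma (k := A) (R := S)

theorem restrictSelf_scalarMap (S : SigmaAlg A) :
    restrictSelf k A ≫ scalarMap k S =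
      (restrict (SigmaRingHom.ofAlgebra k A)).map (ofSelf S) :=
  SigmaAlg.hom_ext fun _ => rfl

/-- The trivialization of a torsor by a point. -/
noncomputable def isoOfPoint (X : SigmaTorsor G) (x : X.points.obj (of k A)) :
    GFunctor.Iso ((GFunctor.self G.points).baseChange (SigmaRingHom.ofAlgebra k A))
      (X.toGFunctor.baseChange (SigmaRingHom.ofAlgebra k A)) where
  iso := NatIso.ofComponents
    (fun S => Equiv.toIso (Equiv.ofBijective
      (fun g : G.points.obj ((restrict (SigmaRingHom.ofAlgebra k A)).obj S) =>
        g • X.points.map (scalarMap k S) x)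
      ⟨fun _ _ h => X.smul_right_cancel h, fun y => X.exists_smul_eq _ y⟩))
    (fun {S T} f => by
      ext g
      change G.points.map ((restrict (SigmaRingHom.ofAlgebra k A)).map f) g •
          X.points.map (scalarMap k T) x =
        X.points.map ((restrict (SigmaRingHom.ofAlgebra k A)).map f)
          ((show G.points.obj _ from g) • X.points.map (scalarMap k S) x)
      rw [X.map_smul, ← points_map_comp_apply, scalarMap_comp])
  map_smul S g h := mul_smul (show G.points.obj _ from g) (show G.points.obj _ from h)
    (X.points.map (scalarMap k S) x)

/-- The point given by a trivialization of a torsor. -/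
noncomputable def pointOfIso {X : SigmaTorsor G}
    (γ : GFunctor.Iso ((GFunctor.self G.points).baseChange (SigmaRingHom.ofAlgebra k A))
      (X.toGFunctor.baseChange (SigmaRingHom.ofAlgebra k A))) : X.points.obj (of k A) :=
  X.points.map (restrictSelf k A) (γ.iso.hom.app (of A A)
    (1 : G.points.obj ((restrict (SigmaRingHom.ofAlgebra k A)).obj (of A A))))

/-- By equivariance the map is determined by the images of `1`, and by naturality these all come
from the initial `A`-`σ`-algebra `A`. -/
theorem iso_apply {X : SigmaTorsor G}
    (γ : GFunctor.Iso ((GFunctor.self G.points).baseChange (SigmaRingHom.ofAlgebra k A))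
      (X.toGFunctor.baseChange (SigmaRingHom.ofAlgebra k A))) (S : SigmaAlg A)
    (g : G.points.obj ((restrict (SigmaRingHom.ofAlgebra k A)).obj S)) :
    γ.iso.hom.app S g = (g • X.points.map (scalarMap k S) (pointOfIso γ) : X.points.obj _) := by
  have h1 := γ.map_smul S g (1 : G.points.obj ((restrict (SigmaRingHom.ofAlgebra k A)).obj S))
  have h2 := NatTrans.naturality_apply γ.iso.hom (ofSelf S)
    (1 : G.points.obj ((restrict (SigmaRingHom.ofAlgebra k A)).obj (of A A)))
  have h3 : (((GFunctor.self G.points).baseChange (SigmaRingHom.ofAlgebra k A)).points.map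
      (ofSelf S)) (1 : G.points.obj ((restrict (SigmaRingHom.ofAlgebra k A)).obj (of A A))) =
        (1 : G.points.obj ((restrict (SigmaRingHom.ofAlgebra k A)).obj S)) :=
    map_one (G.points.map ((restrict (SigmaRingHom.ofAlgebra k A)).map (ofSelf S))).hom
  rw [h3] at h2
  have h4 : (g • (1 : G.points.obj ((restrict (SigmaRingHom.ofAlgebra k A)).obj S)) :
      ((GFunctor.self G.points).baseChange (SigmaRingHom.ofAlgebra k A)).points.obj S) = g :=
    mul_one g
  have h5 : X.points.map (scalarMap k S) (pointOfIso γ) = γ.iso.hom.app S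
      (1 : G.points.obj ((restrict (SigmaRingHom.ofAlgebra k A)).obj S)) :=
    (points_map_comp_apply X.points (restrictSelf k A) (scalarMap k S) _).symm.trans
      ((congrArg (fun f => X.points.map f _) (restrictSelf_scalarMap S)).trans h2.symm)
  rw [h5]
  exact (congrArg _ h4.symm).trans h1

theorem isTrivialOver_of_point {X : SigmaTorsor G} (x : X.points.obj (of k A)) :
    X.IsTrivialOver A :=
  (GFunctor.iso_equivalence _).symm ⟨X.isoOfPoint x⟩

theorem IsTrivialOver.nonempty_points {X : SigmaTorsor G} (hX : X.IsTrivialOver A) :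
    Nonempty (X.points.obj (of k A)) := by
  obtain ⟨γ⟩ := (GFunctor.iso_equivalence _).symm hX
  exact ⟨pointOfIso γ⟩

theorem scalarMap_inclRight (S : SigmaAlg (A ⊗[k] A)) :
    scalarMap k ((restrict (inclRight k A).toSigmaRingHom).obj S) ≫ (restrictBase k A).hom.app S =
      inclRight k A ≫ structureMap k A S :=
  SigmaAlg.hom_ext fun _ => rfl

theorem scalarMap_inclLeft (S : SigmaAlg (A ⊗[k] A)) :
    scalarMap k ((restrict (inclLeft k A).toSigmaRingHom).obj S) =
      inclLeft k A ≫ structureMap k A S :=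
  SigmaAlg.hom_ext fun _ => rfl

/-- On `g`, one composite gives `g` times the image of the right pullback of `x`, the other `g`
times the image of `χ` applied to the left pullback. Equality for all `S` reduces to the universal
case `S = A ⊗ A`, `g = 1`. -/
theorem compatible_iff {X : SigmaTorsor G} (χ : G.points.obj (of k (A ⊗[k] A)))
    (γ : GFunctor.Iso ((GFunctor.self G.points).baseChange (SigmaRingHom.ofAlgebra k A))
      (X.toGFunctor.baseChange (SigmaRingHom.ofAlgebra k A))) (x : X.points.obj (of k A))
    (hγ : ∀ (S : SigmaAlg A) (g : G.points.obj ((restrict (SigmaRingHom.ofAlgebra k A)).obj S)),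
      γ.iso.hom.app S g = (g • X.points.map (scalarMap k S) x : X.points.obj _)) :
    CompatibleWithDescent (rightMulDatum G χ) (canonicalDatum A X.points) γ.iso.hom ↔
      X.IsDifference x χ := by
  have hl : ∀ (S : SigmaAlg (A ⊗[k] A)) (g : G.points.obj
      ((restrict (SigmaRingHom.ofAlgebra k A)).obj
        ((restrict (inclRight k A).toSigmaRingHom).obj S))),
      (Functor.whiskerLeft (restrict (inclRight k A).toSigmaRingHom) γ.iso.hom ≫
        (canonicalDatum A X.points).hom).app S g =
      (G.points.map ((restrictBase k A).hom.app S) g •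
        X.points.map (structureMap k A S) (X.points.map (inclRight k A) x) :
          X.points.obj _) := by
    intro S g
    change X.points.map ((restrictBase k A).hom.app S) (γ.iso.hom.app _ g) = _
    rw [hγ]
    refine (X.map_smul _ _ _).trans ?_
    rw [← points_map_comp_apply, ← points_map_comp_apply, scalarMap_inclRight]
  have hr : ∀ (S : SigmaAlg (A ⊗[k] A)) (g : G.points.obj
      ((restrict (SigmaRingHom.ofAlgebra k A)).obj
        ((restrict (inclRight k A).toSigmaRingHom).obj S))),
      ((rightMulDatum G χ).hom ≫
        Functor.whiskerLeft (restrict (inclLeft k A).toSigmaRingHom) γ.iso.hom).app S g =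
      (G.points.map ((restrictBase k A).hom.app S) g •
        X.points.map (structureMap k A S) (χ • X.points.map (inclLeft k A) x) :
          X.points.obj _) := by
    intro S g
    refine (hγ _ _).trans ?_
    rw [X.map_smul, ← points_map_comp_apply, smul_smul, scalarMap_inclLeft]
    rfl
  constructor
  · intro h
    let S : SigmaAlg (A ⊗[k] A) := of (A ⊗[k] A) (A ⊗[k] A)
    have h1 := (hl S 1).symm.trans
      ((ConcreteCategory.congr_hom (NatTrans.congr_app h S) _).trans (hr S 1))
    have h3 : X.points.map (structureMap k A S) (X.points.map (inclRight k A) x) =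
        X.points.map (structureMap k A S) (χ • X.points.map (inclLeft k A) x) :=
      (@MulAction.injective _ _ _ (X.mulAction _) _) h1
    -- For this `S` the structure map is the identity on elements; `q` undoes it, passing back to
    -- the original `k`-structure.
    let q : (restrict (inclLeft k A).toSigmaRingHom ⋙
        restrict (SigmaRingHom.ofAlgebra k A)).obj S ⟶ of k (A ⊗[k] A) :=
      { toAlgHom :=
          { toRingHom := RingHom.id (A ⊗[k] A)
            commutes' := fun _ => rfl }
        map_sigma := fun _ => rfl }
    have hq : structureMap k A S ≫ q = 𝟙 _ := SigmaAlg.hom_ext fun _ => rfl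
    have h4 : ∀ y : X.points.obj (of k (A ⊗[k] A)),
        X.points.map q (X.points.map (structureMap k A S) y) = y := fun y => by
      rw [← points_map_comp_apply, hq, points_map_id_apply]
    exact (h4 _).symm.trans ((congrArg _ h3).trans (h4 _))
  · intro h
    unfold CompatibleWithDescent
    ext S g
    refine (hl S g).trans (Eq.trans ?_ (hr S g).symm)
    rw [show X.points.map (inclRight k A) x = χ • X.points.map (inclLeft k A) x from h]

/-- Up to identifications that are the identity on rings, the two sides are right multiplication by
the images of `∂₂ χ` and `∂₁ χ * ∂₃ χ`. -/
theorem isDescentDatum_rightMulDatum {χ : G.points.obj (of k (A ⊗[k] A))} (hχ : IsCocycle χ) :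
    IsDescentDatum _ (rightMulDatum G χ) := by
  intro T x
  let r := restrict (SigmaRingHom.ofAlgebra k A)
  -- The structure map of `T`, with `T` given the `k`-structure under which both sides of the
  -- identity are formed.
  let τ : of k (A ⊗[k] (A ⊗[k] A)) ⟶ r.obj ((restrict (inclLeft k A).toSigmaRingHom).obj
      ((restrict (face₃ k A).toSigmaRingHom).obj T)) :=
    { toAlgHom :=
        { toRingHom := algebraMap (A ⊗[k] (A ⊗[k] A)) T
          commutes' := fun a => by
            change algebraMap _ T (algebraMap k _ a) = algebraMap _ T
              ((face₃ k A).toAlgHom ((inclLeft k A).toAlgHom (algebraMap k A a)))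
            rw [AlgHom.commutes, AlgHom.commutes] }
      map_sigma := SigmaAlgebra.algebraMap_sigma (k := A ⊗[k] (A ⊗[k] A)) (R := T) }
  have h := congrArg (G.points.map τ) hχ
  rw [map_mul, ← G.map_comp_apply, ← G.map_comp_apply, ← G.map_comp_apply] at h
  change G.points.map (r.map ((first₂₃ k A).hom.app T))
      (G.points.map ((restrictBase k A).hom.app _)
        (G.points.map (r.map ((third₁₂ k A).hom.app T)) x) * G.points.map (structureMap k A _) χ) =
    G.points.map ((restrictBase k A).hom.app _) (G.points.map (r.map ((second₁₃ k A).hom.app T))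
      (G.points.map ((restrictBase k A).hom.app _) x * G.points.map (structureMap k A _) χ)) *
        G.points.map (structureMap k A _) χ
  simp only [map_mul, ← G.map_comp_apply]
  rw [mul_assoc]
  exact congrArg₂ _ rfl h

end BaseChange

/-! ### The twist as a torsor -/

section Twist

variable {k : Type u} [CommRing k] [SigmaRing k]
  {A : Type u} [CommRing A] [SigmaRing A] [Algebra k A] [SigmaAlgebra k A]
  [Module.FaithfullyFlat k A] {G : SigmaAlgebraicGroup k}

/-- The torsor obtained by twisting `G` with a cocycle. -/
noncomputable def ofCocycle (χ : Cocycle A G) : SigmaTorsor G where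
  toGFunctor := twist χ.1
  isSigmaVariety := twist_isSigmaVariety ((isCocycle_iff χ.1).1 χ.2)
  nonempty _ := ⟨of k A, (FaithfulSMul.algebraMap_injective k A).nontrivial,
    ⟨⟨χ.1, (isCocycle_iff χ.1).1 χ.2⟩⟩⟩
  bijective := twist_bijective χ.1

/-- The point is `χ` itself; that its difference is `χ` is once more the cocycle condition. -/
theorem exists_isDifference_ofCocycle (χ : Cocycle A G) :
    ∃ x : (ofCocycle χ).points.obj (of k A), (ofCocycle χ).IsDifference x χ.1 := by
  refine ⟨⟨χ.1, (isCocycle_iff χ.1).1 χ.2⟩, Subtype.ext ?_⟩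
  exact (isCocycle_iff χ.1).1 χ.2

end Twist

end SigmaTorsor

namespace SigmaTorsor

/-! ### The bijection with cohomology -/

section Classification

variable {k : Type u} [CommRing k] [SigmaRing k] (G : SigmaAlgebraicGroup k)
  (A : Type u) [CommRing A] [SigmaRing A] [Algebra k A] [SigmaAlgebra k A]

variable {G A} in
/-- Any two difference cocycles of points of isomorphic torsors are equivalent. -/
theorem mk_eq_of_iso {X Y : SigmaTorsor G} (i : GFunctor.Iso X.toGFunctor Y.toGFunctor)
    {x : X.points.obj (SigmaAlg.of k A)} {y : Y.points.obj (SigmaAlg.of k A)} {χ ψ : Cocycle A G}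
    (hx : X.IsDifference x χ.1) (hy : Y.IsDifference y ψ.1) : H1.mk χ = H1.mk ψ :=
  equivalent_of_isDifference (hx.map i) hy

/-- The map that sends a torsor to the class of the difference cocycle of any of its points. -/
noncomputable def cohomologyClass : TorsorClasses A G → H1 A G :=
  Quotient.lift
    (fun X => H1.mk (X.1.exists_isDifference X.2.nonempty_points.some).choose) (by
      rintro X Y ⟨i⟩
      exact mk_eq_of_iso i (X.1.exists_isDifference X.2.nonempty_points.some).choose_spec
        (Y.1.exists_isDifference Y.2.nonempty_points.some).choose_spec)

variable {G A}

theorem cohomologyClass_mk {X : SigmaTorsor G} (hX : X.IsTrivialOver A)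
    {x : X.points.obj (SigmaAlg.of k A)} {χ : Cocycle A G} (h : X.IsDifference x χ.1) :
    cohomologyClass G A (TorsorClasses.mk X hX) = H1.mk χ :=
  equivalent_of_isDifference (X.exists_isDifference hX.nonempty_points.some).choose_spec h

/-- Equality of classes is improved to an `A`-point whose difference is exactly `χ`. Both
injectivity and the descent criterion rest on this. -/
theorem cohomologyClass_mk_eq_iff {X : SigmaTorsor G} (hX : X.IsTrivialOver A)
    {χ : Cocycle A G} : cohomologyClass G A (TorsorClasses.mk X hX) = H1.mk χ ↔
      ∃ x, X.IsDifference x χ.1 := by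
  refine ⟨fun h => ?_, fun ⟨x, h⟩ => cohomologyClass_mk hX h⟩
  obtain ⟨ψ, hψ⟩ := X.exists_isDifference hX.nonempty_points.some
  exact exists_isDifference_of_equivalent hψ (h.symm.trans (cohomologyClass_mk hX hψ))

variable (G A) in
theorem cohomologyClass_bijective [Module.FaithfullyFlat k A] :
    Function.Bijective (cohomologyClass G A) := by
  constructor
  · rintro ⟨X, hX⟩ ⟨Y, hY⟩ h
    obtain ⟨χ, hχ⟩ := X.exists_isDifference hX.nonempty_points.some
    obtain ⟨y, hy⟩ := (cohomologyClass_mk_eq_iff hY).1 (h.symm.trans (cohomologyClass_mk hX hχ))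
    exact Quotient.sound (nonempty_iso_of_isDifference hχ hy)
  · rintro ⟨χ⟩
    obtain ⟨x, hx⟩ := exists_isDifference_ofCocycle χ
    exact ⟨TorsorClasses.mk _ (isTrivialOver_of_point x), cohomologyClass_mk _ hx⟩

theorem cohomologyClass_base :
    cohomologyClass G A (TorsorClasses.base A G) = H1.base A G := by
  refine cohomologyClass_mk _ (x := (1 : G.points.obj (SigmaAlg.of k A))) ?_
  change G.points.map (SigmaAlg.inclRight k A) 1 = 1 * G.points.map (SigmaAlg.inclLeft k A) 1
  rw [map_one, map_one, mul_one]

end Classification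

end SigmaTorsor

theorem theorem4p1 {k : Type u} [CommRing k] [SigmaRing k] (G : SigmaAlgebraicGroup k)
    (A : Type u) [CommRing A] [SigmaRing A] [Algebra k A] [SigmaAlgebra k A]
    [Module.FaithfullyFlat k A] :
    ∃ e : TorsorClasses A G ≃ H1 A G,
      -- isomorphism of pointed sets
      e (TorsorClasses.base A G) = H1.base A G ∧
      -- the class of a torsor is read off from any of its points over `A`
      (∀ (X : SigmaTorsor G) (hX : X.IsTrivialOver A) (x : X.points.obj (SigmaAlg.of k A)),
        ∃ χ : Cocycle A G,
          (∀ g : G.points.obj (SigmaAlg.of k (A ⊗[k] A)),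
            X.points.map (SigmaAlg.inclRight k A) x = g • X.points.map (SigmaAlg.inclLeft k A) x ↔
              g = χ.1) ∧
          e (TorsorClasses.mk X hX) = H1.mk χ) ∧
      -- a cocycle gives a descent datum on `G_A`, which descends to the corresponding torsors
      (∀ χ : Cocycle A G,
        IsDescentDatum _ (rightMulDatum G χ.1) ∧
        ∀ (X : SigmaTorsor G) (hX : X.IsTrivialOver A),
          e (TorsorClasses.mk X hX) = H1.mk χ ↔
            ∃ γ : GFunctor.Iso
                ((GFunctor.self G.points).baseChange (SigmaRingHom.ofAlgebra k A))
                (X.toGFunctor.baseChange (SigmaRingHom.ofAlgebra k A)),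
              CompatibleWithDescent (rightMulDatum G χ.1) (canonicalDatum A X.points)
                γ.iso.hom) := by
  refine ⟨Equiv.ofBijective _ (SigmaTorsor.cohomologyClass_bijective G A),
    SigmaTorsor.cohomologyClass_base, fun X hX x => ?_, fun χ =>
      ⟨SigmaTorsor.isDescentDatum_rightMulDatum χ.2, fun X hX => ?_⟩⟩
  · obtain ⟨χ, hχ⟩ := X.exists_isDifference x
    refine ⟨χ, fun g => ⟨fun hg => X.smul_right_cancel (hg.symm.trans hχ), fun hg => ?_⟩,
      SigmaTorsor.cohomologyClass_mk hX hχ⟩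
    rw [hg]
    exact hχ
  -- Points with difference `χ` and compatible trivializations are exchanged by `x ↦ (g ↦ g.x)` and
  -- evaluation at `1`.
  · refine (SigmaTorsor.cohomologyClass_mk_eq_iff hX).trans
      ⟨fun ⟨x, hx⟩ => ⟨X.isoOfPoint x, ?_⟩, fun ⟨γ, hγ⟩ => ⟨SigmaTorsor.pointOfIso γ, ?_⟩⟩
    · exact (SigmaTorsor.compatible_iff χ.1 _ x fun _ _ => rfl).2 hx
    · exact (SigmaTorsor.compatible_iff χ.1 γ _ (SigmaTorsor.iso_apply γ)).1 hγ
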